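/- Let $N\ge 0$, $k\ge 1$ and let $d_1\le d_2\le\dots\le d_k=N$ be non-negative integers. Let $X$ be the complex manifold of all flags $V_1\subseteq V_2\subseteq\dots\subseteq V_k=\mathbb{C}^N$ of linear subspaces with $\dim V_i=d_i$; its dimension is $n=\sum_{j=1}^{k-1}d_j(d_{j+1}-d_j)$. For each $i$ let $H_i=\{(x,v)\in X\times\mathbb{C}^N: v\in V_i(x)\}$ be the tautological bundle, $F_i=(X\times\mathbb{C}^N)/H_i$ the quotient bundle, $q_i:X\times\mathbb{C}^N\to F_i$ the projection and $Q_i:F_i\to F_{i+1}$, $v+H_i\mapsto v+H_{i+1}$, the natural map. Denote points of $X\times X$ by $(z,\zeta)$, and let the subscripts $z$, $\zeta$ denote pullback from the first and the second factor, respectively. Consider the holomorphic vector bundle $\bigoplus_{i=1}^{k-1}\mathrm{Hom}(H_{i,\zeta},F_{i,z})$ over $X\times X$, its section $\eta=\sum_{i=1}^{k-1}\eta_i$ with $\eta_i(z,\zeta)v=q_{i,z}(v)$ for $v\in H_{i,\zeta}$, and the morphism $$\Phi:\bigoplus_{i=1}^{k-1}\mathrm{Hom}(H_{i,\zeta},F_{i,z})\to\bigoplus_{i=1}^{k-2}\mathrm{Hom}(H_{i,\zeta},F_{i+1,z}),\qquad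 \Phi\Big(\sum_{i=1}^{k-1} f_i\Big)=\sum_{i=1}^{k-2}\big(f_{i+1}|_{H_{i,\zeta}}-Q_i\circ f_i\big).$$ Then $E:=\ker\Phi$ is a holomorphic subbundle of rank $n=\dim X$, and $\eta$ is a holomorphic section of $E$ which defines the diagonal $\Delta\subset X\times X$: it vanishes to first order along $\Delta$ (that is, $\eta=0$ on $\Delta$, and at each point of $\Delta$ the differentials of the $n$ components of $\eta$ in a local holomorphic frame of $E$ are linearly independent), and it is non-zero outside $\Delta$. Consequently $X$ has the Diagonal Property: there are a holomorphic vector bundle over $X\times X$ of rank $\dim X$ and a holomorphic section of it which vanishes to first order on the diagonal and is non-zero elsewhere. -/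

import Mathlib

open Module
open scoped Matrix Manifold ContDiff Bundle Topology

/-- A type `(d_1, …, d_k)` of flags in `ℂ^N`: dimensions `d_1 ≤ … ≤ d_k = N`
(`k ≥ 1`, entries indexed from `0`). -/
structure FlagType (N : ℕ) where
  k : ℕ
  k_pos : 0 < k
  d : Fin k → ℕ
  mono : Monotone d
  d_last : d ⟨k - 1, Nat.sub_lt k_pos Nat.one_pos⟩ = N

namespace FlagType

variable {N : ℕ} (τ : FlagType N)

/-- The set `X` of flags `V_1 ⊆ … ⊆ V_k` of subspaces of `ℂ^N` with `dim V_i = d_i`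
(so `V_k = ℂ^N`, as `d_k = N`). -/
@[ext] structure Flag where
  V : Fin τ.k → Submodule ℂ (Fin N → ℂ)
  mono : Monotone V
  finrank_eq : ∀ i, finrank ℂ (V i) = τ.d i

/-- The span of the standard basis vectors `e_c`, `c < m`. -/
def stdSub (N m : ℕ) : Submodule ℂ (Fin N → ℂ) where
  carrier := {v | ∀ a : Fin N, m ≤ a → v a = 0}
  add_mem' := by
    intro v w hv hw a ha
    simp [hv a ha, hw a ha]
  zero_mem' := by
    intro a _
    rfl
  smul_mem' := by
    intro c v hv a ha
    simp [hv a ha]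

theorem mem_stdSub {N m : ℕ} {v : Fin N → ℂ} :
    v ∈ stdSub N m ↔ ∀ a : Fin N, m ≤ a → v a = 0 := Iff.rfl

theorem d_le (i : Fin τ.k) : τ.d i ≤ N := by
  have h := τ.mono (show i ≤ ⟨τ.k - 1, Nat.sub_lt τ.k_pos Nat.one_pos⟩ by
    rw [Fin.le_def]; have := i.2; simp only; omega)
  exact h.trans τ.d_last.le

theorem finrank_stdSub {N m : ℕ} (hm : m ≤ N) : finrank ℂ (stdSub N m) = m := by
  let e : stdSub N m ≃ₗ[ℂ] (Fin m → ℂ) :=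
    { toFun := fun v c => v.1 (Fin.castLE hm c)
      map_add' := fun _ _ => rfl
      map_smul' := fun _ _ => rfl
      invFun := fun w => ⟨fun a => if h : (a : ℕ) < m then w ⟨a, h⟩ else 0, by
        intro a ha
        simp [not_lt.2 ha]⟩
      left_inv := by
        intro v
        ext a
        by_cases h : (a : ℕ) < m
        · simp [h]
        · simp [h, v.2 a (not_lt.1 h)]
      right_inv := by
        intro w
        ext c
        simp }
  rw [e.finrank_eq, finrank_fin_fun]

/-- The linear automorphism of `ℂ^N` given by an invertible matrix. -/
noncomputable def glEquiv (g : GL (Fin N) ℂ) : (Fin N → ℂ) ≃ₗ[ℂ] (Fin N → ℂ) :=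
  LinearEquiv.ofLinearMap (Matrix.toLin' g.1) (Matrix.toLin' (g⁻¹).1)
    (by rw [← Matrix.toLin'_mul, ← Units.val_mul, mul_inv_cancel]; simp)
    (by rw [← Matrix.toLin'_mul, ← Units.val_mul, inv_mul_cancel]; simp)

@[simp] theorem glEquiv_apply (g : GL (Fin N) ℂ) (v : Fin N → ℂ) :
    glEquiv g v = g.1 *ᵥ v := rfl

@[simp] theorem glEquiv_symm_apply (g : GL (Fin N) ℂ) (v : Fin N → ℂ) :
    (glEquiv g).symm v = (g⁻¹).1 *ᵥ v := rfl

/-- The flag `g · F₀`, where `F₀` is the standard flag. -/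
noncomputable def orbit (g : GL (Fin N) ℂ) : τ.Flag where
  V i := (stdSub N (τ.d i)).map (glEquiv g).toLinearMap
  mono := by
    intro i j hij
    refine Submodule.map_mono ?_
    intro v hv a ha
    exact hv a ((τ.mono hij).trans ha)
  finrank_eq i := by
    rw [LinearEquiv.finrank_map_eq, finrank_stdSub (τ.d_le i)]

theorem mem_orbit {g : GL (Fin N) ℂ} {i : Fin τ.k} {v : Fin N → ℂ} :
    v ∈ (τ.orbit g).V i ↔ ∀ a : Fin N, τ.d i ≤ a → ((g⁻¹).1 *ᵥ v) a = 0 := by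
  constructor
  · rintro ⟨w, hw, rfl⟩ a ha
    have h : (g⁻¹).1 *ᵥ (glEquiv g w) = w := (glEquiv g).symm_apply_apply w
    simpa [h] using hw a ha
  · intro h
    exact ⟨(glEquiv g).symm v, h, (glEquiv g).apply_symm_apply v⟩

theorem orbit_mul (g h : GL (Fin N) ℂ) (i : Fin τ.k) :
    (τ.orbit (g * h)).V i = ((τ.orbit h).V i).map (glEquiv g).toLinearMap := by
  ext v
  rw [mem_orbit]
  constructor
  · intro hv
    refine ⟨(glEquiv g).symm v, ?_, (glEquiv g).apply_symm_apply v⟩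
    rw [SetLike.mem_coe, mem_orbit]
    intro a ha
    have := hv a ha
    rwa [mul_inv_rev, Units.val_mul, ← Matrix.mulVec_mulVec] at this
  · rintro ⟨w, hw, rfl⟩ a ha
    rw [SetLike.mem_coe, mem_orbit] at hw
    have h1 : (g⁻¹).1 *ᵥ (glEquiv g w) = w := (glEquiv g).symm_apply_apply w
    rw [mul_inv_rev, Units.val_mul, ← Matrix.mulVec_mulVec]
    have : (glEquiv g).toLinearMap w = glEquiv g w := rfl
    rw [this, h1]
    exact hw a ha

theorem orbit_mul_left_cancel (g h h' : GL (Fin N) ℂ) (e : τ.orbit (g * h) = τ.orbit (g * h')) :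
    τ.orbit h = τ.orbit h' := by
  ext1
  funext i
  have := congrArg (fun x => Flag.V x i) e
  simp only [orbit_mul] at this
  exact Submodule.map_injective_of_injective (glEquiv g).injective this

theorem orbit_mul_congr (g : GL (Fin N) ℂ) {h h' : GL (Fin N) ℂ} (e : τ.orbit h = τ.orbit h') :
    τ.orbit (g * h) = τ.orbit (g * h') := by
  ext1
  funext i
  rw [orbit_mul, orbit_mul, e]

theorem exists_equiv_map {V : Type*} [AddCommGroup V] [Module ℂ V] [FiniteDimensional ℂ V]
    (B C : Submodule ℂ V) (h : finrank ℂ B = finrank ℂ C) :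
    ∃ g : V ≃ₗ[ℂ] V, ∀ v ∈ B, g v ∈ C := by
  obtain ⟨D, hD⟩ := B.exists_isCompl
  obtain ⟨D', hD'⟩ := C.exists_isCompl
  have h1 := Submodule.finrank_add_eq_of_isCompl hD
  have h2 := Submodule.finrank_add_eq_of_isCompl hD'
  let e : B ≃ₗ[ℂ] C := LinearEquiv.ofFinrankEq _ _ h
  let e' : D ≃ₗ[ℂ] D' := LinearEquiv.ofFinrankEq _ _ (by omega)
  refine ⟨(B.prodEquivOfIsCompl D hD).symm ≪≫ₗ (e.prodCongr e') ≪≫ₗ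
    C.prodEquivOfIsCompl D' hD', ?_⟩
  intro v hv
  have : (B.prodEquivOfIsCompl D hD).symm v = (⟨v, hv⟩, 0) := by
    rw [LinearEquiv.symm_apply_eq]; simp
  simp [this]

theorem exists_equiv_fix {V : Type*} [AddCommGroup V] [Module ℂ V] [FiniteDimensional ℂ V]
    (A B C : Submodule ℂ V) (hB : A ≤ B) (hC : A ≤ C) (h : finrank ℂ B = finrank ℂ C) :
    ∃ g : V ≃ₗ[ℂ] V, (∀ v ∈ A, g v = v) ∧ B.map g.toLinearMap = C := by
  obtain ⟨Q, hQ⟩ := A.exists_isCompl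
  have key : ∀ B : Submodule ℂ V, A ≤ B →
      finrank ℂ (B.comap Q.subtype) + finrank ℂ A = finrank ℂ B := by
    intro B hB
    have h1 : A ⊔ (B ⊓ Q) = B := by
      rw [inf_comm, ← sup_inf_assoc_of_le Q hB, hQ.sup_eq_top, top_inf_eq]
    have h2 : A ⊓ (B ⊓ Q) = ⊥ := by
      rw [← le_bot_iff, ← hQ.inf_eq_bot]
      exact inf_le_inf_left _ inf_le_right
    have h3 := Submodule.finrank_sup_add_finrank_inf_eq A (B ⊓ Q)
    rw [h1, h2, finrank_bot] at h3
    have h4 : B.comap Q.subtype = (B ⊓ Q).comap Q.subtype := by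
      ext v; simp
    have h5 := (Submodule.comapSubtypeEquivOfLe (inf_le_right : B ⊓ Q ≤ Q)).finrank_eq
    rw [h4, h5]
    omega
  obtain ⟨e, he⟩ := exists_equiv_map (B.comap Q.subtype) (C.comap Q.subtype) (by
    have := key B hB; have := key C hC; omega)
  let P := A.prodEquivOfIsCompl Q hQ
  let g : V ≃ₗ[ℂ] V := P.symm ≪≫ₗ ((LinearEquiv.refl ℂ A).prodCongr e) ≪≫ₗ P
  have hg : ∀ (a : A) (q : Q), g (a + q) = a + e q := by
    intro a q
    have : P.symm (a + q) = (a, q) := by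
      rw [LinearEquiv.symm_apply_eq]; simp [P]
    simp [g, this, P]
  have hgB : ∀ v ∈ B, g v ∈ C := by
    intro v hv
    obtain ⟨⟨a, q⟩, rfl⟩ := P.surjective v
    have hP : P (a, q) = a + q := by simp [P]
    rw [hP] at hv ⊢
    rw [hg]
    refine C.add_mem (hC a.2) (he q ?_)
    have := B.sub_mem hv (hB a.2)
    simpa using this
  refine ⟨g, ?_, ?_⟩
  · intro v hv
    have := hg ⟨v, hv⟩ 0
    simpa using this
  · refine Submodule.eq_of_le_of_finrank_eq ?_ ?_
    · rintro _ ⟨v, hv, rfl⟩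
      exact hgB v hv
    · rw [LinearEquiv.finrank_map_eq, h]

theorem exists_glEquiv (e : (Fin N → ℂ) ≃ₗ[ℂ] (Fin N → ℂ)) :
    ∃ g : GL (Fin N) ℂ, glEquiv g = e := by
  refine ⟨⟨LinearMap.toMatrix' e.toLinearMap, LinearMap.toMatrix' e.symm.toLinearMap, ?_, ?_⟩, ?_⟩
  · rw [← LinearMap.toMatrix'_comp]; simp
  · rw [← LinearMap.toMatrix'_comp]; simp
  · ext1 v
    simp [LinearMap.toMatrix'_mulVec]

/-- `GL(N, ℂ)` acts transitively on flags. -/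
theorem exists_orbit_eq (x : τ.Flag) : ∃ g : GL (Fin N) ℂ, τ.orbit g = x := by
  suffices H : ∀ m : ℕ, ∃ g : (Fin N → ℂ) ≃ₗ[ℂ] (Fin N → ℂ),
      ∀ i : Fin τ.k, (i : ℕ) < m → (stdSub N (τ.d i)).map g.toLinearMap = x.V i by
    obtain ⟨e, he⟩ := H τ.k
    obtain ⟨g, rfl⟩ := exists_glEquiv e
    refine ⟨g, ?_⟩
    ext1
    funext i
    exact he i i.2
  intro m
  induction m with
  | zero => exact ⟨LinearEquiv.refl _ _, fun i hi => absurd hi (Nat.not_lt_zero _)⟩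
  | succ m ih =>
    obtain ⟨g, hg⟩ := ih
    by_cases hm : m < τ.k
    swap
    · exact ⟨g, fun i _ => hg i (by have := i.2; omega)⟩
    obtain ⟨A, hA1, hA2, hA3⟩ : ∃ A : Submodule ℂ (Fin N → ℂ),
        A ≤ (stdSub N (τ.d ⟨m, hm⟩)).map g.toLinearMap ∧ A ≤ x.V ⟨m, hm⟩ ∧
        ∀ i : Fin τ.k, (i : ℕ) < m → x.V i ≤ A := by
      rcases Nat.eq_zero_or_pos m with rfl | h0
      · exact ⟨⊥, bot_le, bot_le, fun i hi => absurd hi (Nat.not_lt_zero _)⟩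
      · refine ⟨x.V ⟨m - 1, by omega⟩, ?_, ?_, ?_⟩
        · rw [← hg ⟨m - 1, by omega⟩ (by simp only; omega)]
          refine Submodule.map_mono ?_
          intro v hv a ha
          exact hv a ((τ.mono (by rw [Fin.le_def]; simp only; omega)).trans ha)
        · exact x.mono (by rw [Fin.le_def]; simp only; omega)
        · intro i hi
          exact x.mono (by rw [Fin.le_def]; simp only; omega)
    obtain ⟨h, hfix, hmap⟩ := exists_equiv_fix A _ _ hA1 hA2 (by
      rw [LinearEquiv.finrank_map_eq, finrank_stdSub (τ.d_le _), x.finrank_eq])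
    refine ⟨g ≪≫ₗ h, ?_⟩
    intro i hi
    have hcomp : (stdSub N (τ.d i)).map (g ≪≫ₗ h).toLinearMap =
        ((stdSub N (τ.d i)).map g.toLinearMap).map h.toLinearMap := by
      rw [← Submodule.map_comp]; rfl
    rw [hcomp]
    rcases Nat.lt_succ_iff_lt_or_eq.1 hi with h1 | h1
    · rw [hg i h1]
      ext v
      constructor
      · rintro ⟨w, hw, rfl⟩
        have := hfix w (hA3 i h1 hw)
        rw [LinearEquiv.coe_coe, this]
        exact hw
      · intro hv
        exact ⟨v, hv, hfix v (hA3 i h1 hv)⟩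
    · have : i = ⟨m, hm⟩ := Fin.ext h1
      rw [this, hmap]

/-- Positions of the entries of the strictly lower block triangular matrices `𝔫` of type `τ`. -/
abbrev Idx : Type := {p : Fin N × Fin N // ∃ i : Fin τ.k, (p.2 : ℕ) < τ.d i ∧ τ.d i ≤ (p.1 : ℕ)}

/-- The matrix `1 + B` for `B ∈ 𝔫`. -/
noncomputable def unipMat (B : τ.Idx → ℂ) : Matrix (Fin N) (Fin N) ℂ :=
  open Classical in
  Matrix.of fun a c => if h : _ then B ⟨(a, c), h⟩ else (1 : Matrix (Fin N) (Fin N) ℂ) a c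

theorem unipMat_lower (B : τ.Idx → ℂ) {a c : Fin N} (h : a < c) : τ.unipMat B a c = 0 := by
  have h1 : ¬ ∃ i : Fin τ.k, (c : ℕ) < τ.d i ∧ τ.d i ≤ (a : ℕ) := by
    rintro ⟨i, h1, h2⟩
    have : (a : ℕ) < c := h
    omega
  simp [unipMat, h1, Matrix.one_apply_ne h.ne]

theorem unipMat_diag (B : τ.Idx → ℂ) (a : Fin N) : τ.unipMat B a a = 1 := by
  have h1 : ¬ ∃ i : Fin τ.k, (a : ℕ) < τ.d i ∧ τ.d i ≤ (a : ℕ) := by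
    rintro ⟨i, h1, h2⟩
    omega
  simp [unipMat, h1]

theorem det_unipMat (B : τ.Idx → ℂ) : (τ.unipMat B).det = 1 := by
  rw [Matrix.det_of_isLowerTriangular]
  · simp [unipMat_diag]
  · intro a c h
    exact τ.unipMat_lower B h

/-- `1 + B`, `B ∈ 𝔫`, as an element of `GL(N, ℂ)`. -/
noncomputable def unip (B : τ.Idx → ℂ) : GL (Fin N) ℂ :=
  Matrix.nonsingInvUnit (τ.unipMat B) (by rw [det_unipMat]; exact isUnit_one)

@[simp] theorem unip_val (B : τ.Idx → ℂ) : (τ.unip B).1 = τ.unipMat B := rfl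

/-- The first `m` columns of `M`, completed by standard basis vectors. -/
noncomputable def cut (m : ℕ) (M : Matrix (Fin N) (Fin N) ℂ) : Matrix (Fin N) (Fin N) ℂ :=
  Matrix.of fun a c => if (c : ℕ) < m then M a c else (1 : Matrix (Fin N) (Fin N) ℂ) a c

theorem cut_mul {m : ℕ} (M p : Matrix (Fin N) (Fin N) ℂ)
    (hp : ∀ a c : Fin N, (c : ℕ) < m → m ≤ (a : ℕ) → p a c = 0) :
    cut m (M * p) = cut m M * cut m p := by
  ext a c
  by_cases hc : (c : ℕ) < m
  · simp only [cut, Matrix.of_apply, Matrix.mul_apply, hc, if_true]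
    refine Finset.sum_congr rfl fun b _ => ?_
    by_cases hb : (b : ℕ) < m
    · simp [hb]
    · simp [hp b c hc (not_lt.1 hb)]
  · have : ∀ b, cut m p b c = (1 : Matrix (Fin N) (Fin N) ℂ) b c := by
      intro b; simp [cut, hc]
    rw [Matrix.mul_apply]
    simp only [this]
    rw [← Matrix.mul_apply, Matrix.mul_one]
    simp [cut, hc]

theorem cut_one (m : ℕ) : cut m (1 : Matrix (Fin N) (Fin N) ℂ) = 1 := by
  ext a c; simp [cut]

/-- If `g · F₀ = h · F₀` then `h⁻¹ g` is block upper triangular. -/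
theorem entry_eq_zero {g h : GL (Fin N) ℂ} (e : τ.orbit g = τ.orbit h) (i : Fin τ.k)
    (a c : Fin N) (hc : (c : ℕ) < τ.d i) (ha : τ.d i ≤ (a : ℕ)) : (h⁻¹ * g).1 a c = 0 := by
  have h1 : g.1 *ᵥ Pi.single c 1 ∈ (τ.orbit g).V i := by
    refine ⟨Pi.single c 1, ?_, rfl⟩
    intro b hb
    rw [Pi.single_eq_of_ne]
    rintro rfl
    omega
  rw [e, mem_orbit] at h1
  have := h1 a ha
  rw [Matrix.mulVec_mulVec, Matrix.mulVec_single_one] at this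
  simpa using this

theorem exists_idx (c : Fin N) :
    ∃ i : Fin τ.k, (c : ℕ) < τ.d i ∧ ∀ j : Fin τ.k, (c : ℕ) < τ.d j → i ≤ j := by
  have hne : ∃ i : Fin τ.k, (c : ℕ) < τ.d i := ⟨_, by rw [τ.d_last]; exact c.2⟩
  have := WellFounded.has_min (wellFounded_lt : WellFounded ((· < ·) : Fin τ.k → Fin τ.k → Prop))
    {i | (c : ℕ) < τ.d i} hne
  obtain ⟨i, hi, h⟩ := this
  exact ⟨i, hi, fun j hj => not_lt.1 (h j hj)⟩

/-- The block to which the column `c` belongs. -/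
noncomputable def idx (c : Fin N) : Fin τ.k := (τ.exists_idx c).choose

theorem lt_idx (c : Fin N) : (c : ℕ) < τ.d (τ.idx c) := (τ.exists_idx c).choose_spec.1

theorem idx_le {c : Fin N} {j : Fin τ.k} (h : (c : ℕ) < τ.d j) : τ.idx c ≤ j :=
  (τ.exists_idx c).choose_spec.2 j h

theorem mem_iff_idx (a c : Fin N) :
    (∃ i : Fin τ.k, (c : ℕ) < τ.d i ∧ τ.d i ≤ (a : ℕ)) ↔ τ.d (τ.idx c) ≤ (a : ℕ) :=
  ⟨fun ⟨_, h1, h2⟩ => (τ.mono (τ.idx_le h1)).trans h2, fun h => ⟨_, τ.lt_idx c, h⟩⟩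

/-- The coordinates in `𝔫` of the flag `M · F₀`, if it is in the standard cell. -/
noncomputable def coord (M : Matrix (Fin N) (Fin N) ℂ) : τ.Idx → ℂ :=
  fun p => -(cut (τ.d (τ.idx p.1.2)) M)⁻¹ p.1.1 p.1.2

/-- The condition on `M` for `M · F₀` to be in the standard cell. -/
def InCell (M : Matrix (Fin N) (Fin N) ℂ) : Prop := ∀ i, (cut (τ.d i) M).det ≠ 0

theorem det_cut_unipMat (B : τ.Idx → ℂ) (m : ℕ) : (cut m (τ.unipMat B)).det = 1 := by
  rw [Matrix.det_of_isLowerTriangular]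
  · refine Finset.prod_eq_one fun a _ => ?_
    simp [cut, unipMat_diag]
  · intro a c h
    have h : a < c := h
    simp [cut, τ.unipMat_lower B h, Matrix.one_apply_ne h.ne]

theorem inCell_coord {M : GL (Fin N) ℂ} {B : τ.Idx → ℂ} (e : τ.orbit M = τ.orbit (τ.unip B)) :
    τ.InCell M.1 ∧ τ.coord M.1 = B := by
  set p : GL (Fin N) ℂ := (τ.unip B)⁻¹ * M with hp
  have hM : M.1 = τ.unipMat B * p.1 := by
    have : M = τ.unip B * p := by simp [hp]
    rw [this]; simp
  have hz : ∀ i a c, (c : Fin N).1 < τ.d i → τ.d i ≤ (a : Fin N).1 → p.1 a c = 0 :=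
    fun i a c hc ha => τ.entry_eq_zero e i a c hc ha
  have hz' : ∀ i a c, (c : Fin N).1 < τ.d i → τ.d i ≤ (a : Fin N).1 → (p⁻¹).1 a c = 0 := by
    intro i a c hc ha
    have := τ.entry_eq_zero e.symm i a c hc ha
    simpa [hp] using this
  have hcut : ∀ i, cut (τ.d i) M.1 = cut (τ.d i) (τ.unipMat B) * cut (τ.d i) p.1 := by
    intro i
    rw [hM, cut_mul _ _ (hz i)]
  have hinv : ∀ i, cut (τ.d i) p.1 * cut (τ.d i) (p⁻¹).1 = 1 := by
    intro i
    rw [← cut_mul _ _ (hz' i), ← Units.val_mul, mul_inv_cancel]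
    exact cut_one _
  have hcell : τ.InCell M.1 := by
    intro i
    rw [hcut, Matrix.det_mul, det_cut_unipMat, one_mul]
    have := congrArg Matrix.det (hinv i)
    rw [Matrix.det_mul, Matrix.det_one] at this
    exact left_ne_zero_of_mul_eq_one this
  refine ⟨hcell, ?_⟩
  funext ⟨⟨a, c⟩, hac⟩
  have ha : τ.d (τ.idx c) ≤ (a : ℕ) := (τ.mem_iff_idx a c).1 hac
  have hc := τ.lt_idx c
  set m := τ.d (τ.idx c) with hm
  have hcut := hcut (τ.idx c)
  have hinv := hinv (τ.idx c)
  have hz' := hz' (τ.idx c)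
  rw [← hm] at hcut hinv hz'
  -- `y = e_c - B_c`
  let y : Fin N → ℂ := fun b => if m ≤ (b : ℕ) then -τ.unipMat B b c else if b = c then 1 else 0
  have hucol : ∀ b : Fin N, (b : ℕ) < m → τ.unipMat B b c = if b = c then 1 else 0 := by
    intro b hb
    have h1 : ¬ ∃ i : Fin τ.k, (c : ℕ) < τ.d i ∧ τ.d i ≤ (b : ℕ) := by
      rw [mem_iff_idx]; omega
    simp only [unipMat, Matrix.of_apply, h1, dite_false]
    rw [Matrix.one_apply]
  have hy : cut m (τ.unipMat B) *ᵥ y = Pi.single c 1 := by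
    funext b
    have h1 : ∀ b', cut m (τ.unipMat B) b b' * y b' =
        (if b' = c then τ.unipMat B b c else 0) +
          (if b' = b then (if m ≤ (b : ℕ) then -τ.unipMat B b c else 0) else 0) := by
      intro b'
      simp only [cut, Matrix.of_apply, y]
      by_cases hb' : (b' : ℕ) < m
      · by_cases hbc : b' = c
        · subst hbc
          by_cases hbb : b' = b
          · subst hbb
            simp [hb', not_le.2 hb']
          · simp [hb', not_le.2 hb', hbb]
        · by_cases hbb : b' = b
          · subst hbb
            simp [hb', not_le.2 hb', hbc]
          · simp [hb', not_le.2 hb', hbc, hbb]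
      · have hbc : b' ≠ c := by rintro rfl; exact hb' hc
        by_cases hbb : b' = b
        · subst hbb
          simp [hb', not_lt.1 hb', hbc]
        · simp [hb', not_lt.1 hb', hbc, hbb, Matrix.one_apply_ne (Ne.symm hbb)]
    rw [Matrix.mulVec, dotProduct]
    simp only [h1, Finset.sum_add_distrib, Finset.sum_ite_eq', Finset.mem_univ, if_true]
    by_cases hb : m ≤ (b : ℕ)
    · have : b ≠ c := by rintro rfl; omega
      simp [hb, this]
    · rw [hucol b (not_le.1 hb)]
      simp [hb, Pi.single_apply]
  have hcol : cut m M.1 *ᵥ (cut m (p⁻¹).1 *ᵥ y) = Pi.single c 1 := by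
    rw [Matrix.mulVec_mulVec, hcut, Matrix.mul_assoc, hinv, Matrix.mul_one, hy]
  have hcol2 : (cut m M.1)⁻¹ *ᵥ Pi.single c 1 = cut m (p⁻¹).1 *ᵥ y := by
    rw [← hcol, Matrix.mulVec_mulVec, Matrix.nonsing_inv_mul _ (hcell (τ.idx c)).isUnit,
      Matrix.one_mulVec]
  have hrow : (cut m (p⁻¹).1 *ᵥ y) a = y a := by
    have : ∀ b, cut m (p⁻¹).1 a b = (1 : Matrix (Fin N) (Fin N) ℂ) a b := by
      intro b
      by_cases hb : (b : ℕ) < m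
      · have hab : a ≠ b := by rintro rfl; omega
        rw [Matrix.one_apply_ne hab, ← hz' a b hb ha]
        simp [cut, hb]
      · simp [cut, hb]
    rw [Matrix.mulVec, dotProduct]
    simp only [this]
    rw [← dotProduct, ← Matrix.mulVec, Matrix.one_mulVec]
  have hfin := congrFun hcol2 a
  rw [hrow, Matrix.mulVec_single_one] at hfin
  have hfin : (cut m M.1)⁻¹ a c = -τ.unipMat B a c := by simpa [y, ha] using hfin
  change -(cut m M.1)⁻¹ a c = _
  rw [hfin, neg_neg]
  simp only [unipMat, Matrix.of_apply]
  exact dif_pos hac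

theorem orbit_unip_coord {M : GL (Fin N) ℂ} (h : τ.InCell M.1) :
    τ.orbit (τ.unip (τ.coord M.1)) = τ.orbit M := by
  have hcol : ∀ c : Fin N, τ.unipMat (τ.coord M.1) *ᵥ Pi.single c 1 ∈
      (τ.orbit M).V (τ.idx c) := by
    intro c
    set m := τ.d (τ.idx c) with hm
    let y : Fin N → ℂ := fun b => if (b : ℕ) < m then (cut m M.1)⁻¹ b c else 0
    refine ⟨y, ?_, ?_⟩
    · intro b hb
      simp only [y]
      rw [if_neg (by omega)]
    · rw [LinearEquiv.coe_coe, glEquiv_apply, Matrix.mulVec_single_one]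
      funext a
      have h1 : ∀ b, M.1 a b * y b = cut m M.1 a b * (cut m M.1)⁻¹ b c -
          (if b = a then (if m ≤ (a : ℕ) then (cut m M.1)⁻¹ a c else 0) else 0) := by
        intro b
        by_cases hb : (b : ℕ) < m
        · by_cases hab : b = a
          · subst hab
            simp [y, hb, cut, not_le.2 hb]
          · simp [y, hb, cut, hab]
        · by_cases hab : b = a
          · subst hab
            have : cut m M.1 b b = 1 := by simp [cut, hb]
            simp [y, hb, not_lt.1 hb, this]
          · have : cut m M.1 a b = 0 := by
              simp [cut, hb, Matrix.one_apply_ne (Ne.symm hab)]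
            simp [y, hb, hab, this]
      rw [Matrix.mulVec, dotProduct]
      simp only [h1, Finset.sum_sub_distrib, Finset.sum_ite_eq', Finset.mem_univ, if_true]
      rw [← Matrix.mul_apply, Matrix.mul_nonsing_inv _ (h (τ.idx c)).isUnit]
      simp only [Matrix.col_apply, unipMat, Matrix.of_apply]
      by_cases ha : m ≤ (a : ℕ)
      · rw [dif_pos ((τ.mem_iff_idx a c).2 ha)]
        have hac : a ≠ c := by
          rintro rfl
          have := τ.lt_idx a
          omega
        rw [Matrix.one_apply_ne hac, if_pos ha, zero_sub]
        rfl
      · rw [dif_neg (fun h => ha ((τ.mem_iff_idx a c).1 h))]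
        simp [ha]
  ext1
  funext i
  refine Submodule.eq_of_le_of_finrank_eq ?_ ?_
  · rintro _ ⟨w, hw, rfl⟩
    rw [LinearEquiv.coe_coe, pi_eq_sum_univ' w, map_sum]
    refine Submodule.sum_mem _ fun c _ => ?_
    rw [map_smul]
    by_cases hc : (c : ℕ) < τ.d i
    · refine Submodule.smul_mem _ _ ((τ.orbit M).mono (τ.idx_le hc) ?_)
      convert hcol c using 2
      rw [glEquiv_apply, unip_val]
    · rw [hw c (not_lt.1 hc), zero_smul]
      exact Submodule.zero_mem _
  · rw [Flag.finrank_eq, Flag.finrank_eq]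

theorem unip_injective {B B' : τ.Idx → ℂ} (e : τ.orbit (τ.unip B) = τ.orbit (τ.unip B')) :
    B = B' :=
  (τ.inCell_coord (M := τ.unip B) (B := B) rfl).2.symm.trans (τ.inCell_coord e).2

/-- The parametrization `B ↦ g (1 + B) · F₀` of the cell around `g · F₀`. -/
noncomputable def cell (g : GL (Fin N) ℂ) (B : τ.Idx → ℂ) : τ.Flag := τ.orbit (g * τ.unip B)

theorem cell_injective (g : GL (Fin N) ℂ) : Function.Injective (τ.cell g) :=
  fun _ _ e => τ.unip_injective (τ.orbit_mul_left_cancel g _ _ e)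

theorem cell_eq_iff (g g' : GL (Fin N) ℂ) (B B' : τ.Idx → ℂ) :
    τ.cell g' B' = τ.cell g B ↔
      τ.InCell (g'⁻¹ * (g * τ.unip B)).1 ∧ τ.coord (g'⁻¹ * (g * τ.unip B)).1 = B' := by
  constructor
  · intro e
    refine τ.inCell_coord ?_
    refine τ.orbit_mul_left_cancel g' _ _ ?_
    rw [mul_inv_cancel_left]
    exact e.symm
  · rintro ⟨h1, h2⟩
    have := τ.orbit_mul_congr g' (τ.orbit_unip_coord h1)
    rw [mul_inv_cancel_left, h2] at this
    exact this

/-- The chart inverse to `B ↦ g (1 + B) · F₀`. -/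
noncomputable def cellChart (g : GL (Fin N) ℂ) : PartialEquiv τ.Flag (τ.Idx → ℂ) where
  toFun := Function.invFun (τ.cell g)
  invFun := τ.cell g
  source := Set.range (τ.cell g)
  target := Set.univ
  map_source' _ _ := Set.mem_univ _
  map_target' B _ := ⟨B, rfl⟩
  left_inv' _ hx := Function.invFun_eq hx
  right_inv' B _ := Function.leftInverse_invFun (τ.cell_injective g) B

theorem cellChart_trans_source (g g' : GL (Fin N) ℂ) :
    ((τ.cellChart g).symm.trans (τ.cellChart g')).source =
      {B | τ.InCell (g'⁻¹ * (g * τ.unip B)).1} := by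
  ext B
  simp only [PartialEquiv.trans_source, PartialEquiv.symm_source, Set.mem_inter_iff,
    Set.mem_preimage, Set.mem_ofPred_eq]
  constructor
  · rintro ⟨-, B', hB'⟩
    exact ((τ.cell_eq_iff g g' B B').1 hB').1
  · intro h
    exact ⟨Set.mem_univ _, _, (τ.cell_eq_iff g g' B _).2 ⟨h, rfl⟩⟩

theorem cellChart_trans_apply (g g' : GL (Fin N) ℂ) {B : τ.Idx → ℂ}
    (h : τ.InCell (g'⁻¹ * (g * τ.unip B)).1) :
    (τ.cellChart g).symm.trans (τ.cellChart g') B = τ.coord (g'⁻¹ * (g * τ.unip B)).1 := by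
  have e := (τ.cell_eq_iff g g' B _).2 ⟨h, rfl⟩
  change Function.invFun (τ.cell g') (τ.cell g B) = _
  rw [← e]
  exact Function.leftInverse_invFun (τ.cell_injective g') _

section ContDiff

variable {E : Type*} [NormedAddCommGroup E] [NormedSpace ℂ E]

theorem contDiff_unipMat (a c : Fin N) : ContDiff ℂ ω fun B : τ.Idx → ℂ => τ.unipMat B a c := by
  by_cases h : ∃ i : Fin τ.k, (c : ℕ) < τ.d i ∧ τ.d i ≤ (a : ℕ)
  · have : (fun B : τ.Idx → ℂ => τ.unipMat B a c) = fun B => B ⟨(a, c), h⟩ := by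
      funext B
      exact dif_pos h
    rw [this]
    exact contDiff_apply ℂ ℂ _
  · have : (fun B : τ.Idx → ℂ => τ.unipMat B a c) =
        fun _ => (1 : Matrix (Fin N) (Fin N) ℂ) a c := by
      funext B
      exact dif_neg h
    rw [this]
    exact contDiff_const

theorem contDiff_mul {M M' : E → Matrix (Fin N) (Fin N) ℂ}
    (h : ∀ a c, ContDiff ℂ ω fun x => M x a c) (h' : ∀ a c, ContDiff ℂ ω fun x => M' x a c)
    (a c : Fin N) : ContDiff ℂ ω fun x => (M x * M' x) a c := by
  simp only [Matrix.mul_apply]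
  exact ContDiff.sum fun b _ => (h a b).mul (h' b c)

theorem contDiff_det {M : E → Matrix (Fin N) (Fin N) ℂ}
    (h : ∀ a c, ContDiff ℂ ω fun x => M x a c) : ContDiff ℂ ω fun x => (M x).det := by
  simp only [Matrix.det_apply]
  refine ContDiff.sum fun σ _ => ContDiff.const_smul _ ?_
  exact contDiff_prod fun a _ => h _ _

theorem contDiff_adjugate {M : E → Matrix (Fin N) (Fin N) ℂ}
    (h : ∀ a c, ContDiff ℂ ω fun x => M x a c) (a c : Fin N) :
    ContDiff ℂ ω fun x => (M x).adjugate a c := by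
  simp only [Matrix.adjugate_apply]
  refine contDiff_det fun a' c' => ?_
  by_cases h' : a' = c
  · subst h'
    simpa using contDiff_const
  · simpa [Matrix.updateRow_ne h'] using h a' c'

theorem contDiff_cut {M : E → Matrix (Fin N) (Fin N) ℂ}
    (h : ∀ a c, ContDiff ℂ ω fun x => M x a c) (m : ℕ) (a c : Fin N) :
    ContDiff ℂ ω fun x => cut m (M x) a c := by
  by_cases h' : (c : ℕ) < m
  · simpa [cut, h'] using h a c
  · simpa [cut, h'] using contDiff_const

theorem contDiffOn_inv {M : E → Matrix (Fin N) (Fin N) ℂ}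
    (h : ∀ a c, ContDiff ℂ ω fun x => M x a c) {s : Set E} (hs : ∀ x ∈ s, (M x).det ≠ 0)
    (a c : Fin N) : ContDiffOn ℂ ω (fun x => (M x)⁻¹ a c) s := by
  have : (fun x => (M x)⁻¹ a c) = fun x => (M x).det⁻¹ * (M x).adjugate a c := by
    funext x
    rw [Matrix.inv_def]
    simp
  rw [this]
  exact ((contDiff_det h).contDiffOn.inv hs).mul (contDiff_adjugate h a c).contDiffOn

theorem contDiff_trans_mat (g : GL (Fin N) ℂ) (h : GL (Fin N) ℂ) (a c : Fin N) :
    ContDiff ℂ ω fun B : τ.Idx → ℂ => (h * (g * τ.unip B)).1 a c := by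
  simp only [Units.val_mul, unip_val]
  exact contDiff_mul (M := fun _ : τ.Idx → ℂ => h.1) (fun _ _ => contDiff_const)
    (contDiff_mul (M := fun _ : τ.Idx → ℂ => g.1) (fun _ _ => contDiff_const)
      τ.contDiff_unipMat) a c

theorem contDiffOn_coord {M : E → Matrix (Fin N) (Fin N) ℂ}
    (h : ∀ a c, ContDiff ℂ ω fun x => M x a c) :
    ContDiffOn ℂ ω (fun x => τ.coord (M x)) {x | τ.InCell (M x)} := by
  rw [contDiffOn_pi]
  intro p
  refine ContDiffOn.neg (contDiffOn_inv (contDiff_cut h _) ?_ _ _)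
  intro x hx
  exact hx _

theorem isOpen_inCell {M : E → Matrix (Fin N) (Fin N) ℂ}
    (h : ∀ a c, ContDiff ℂ ω fun x => M x a c) : IsOpen {x | τ.InCell (M x)} := by
  simp only [InCell, Set.ofPred_forall]
  refine isOpen_iInter_of_finite fun i => ?_
  exact isOpen_ne_fun (contDiff_det (contDiff_cut h _)).continuous continuous_const

end ContDiff

/-- Some `g` with `g · F₀ = x`. -/
noncomputable def frameAt (x : τ.Flag) : GL (Fin N) ℂ := (τ.exists_orbit_eq x).choose

theorem orbit_frameAt (x : τ.Flag) : τ.orbit (τ.frameAt x) = x := (τ.exists_orbit_eq x).choose_spec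

theorem orbit_unip_zero : τ.orbit (τ.unip 0) = τ.orbit 1 := by
  congr 1
  ext a c
  by_cases h : ∃ i : Fin τ.k, (c : ℕ) < τ.d i ∧ τ.d i ≤ (a : ℕ)
  · have hac : a ≠ c := by
      rintro rfl
      obtain ⟨i, h1, h2⟩ := h
      omega
    rw [unip_val, Units.val_one, Matrix.one_apply_ne hac]
    exact dif_pos h
  · exact dif_neg h

theorem mem_cell_frameAt (x : τ.Flag) : x ∈ Set.range (τ.cell (τ.frameAt x)) := by
  refine ⟨0, ?_⟩
  have := τ.orbit_mul_congr (τ.frameAt x) τ.orbit_unip_zero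
  rw [mul_one, orbit_frameAt] at this
  exact this

/-- The atlas of `X` formed by the charts inverse to `B ↦ g (1 + B) · F₀`, `g ∈ GL(N, ℂ)`. -/
noncomputable def chartCore : ChartedSpaceCore (τ.Idx → ℂ) τ.Flag where
  atlas := Set.range τ.cellChart
  chartAt x := τ.cellChart (τ.frameAt x)
  mem_chart_source := τ.mem_cell_frameAt
  chart_mem_atlas _ := ⟨_, rfl⟩
  open_source := by
    rintro _ _ ⟨g, rfl⟩ ⟨g', rfl⟩
    rw [cellChart_trans_source]
    exact τ.isOpen_inCell (τ.contDiff_trans_mat g g'⁻¹)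
  continuousOn_toFun := by
    rintro _ _ ⟨g, rfl⟩ ⟨g', rfl⟩
    rw [cellChart_trans_source]
    refine (τ.contDiffOn_coord (τ.contDiff_trans_mat g g'⁻¹)).continuousOn.congr ?_
    intro B hB
    exact τ.cellChart_trans_apply g g' hB

noncomputable instance : TopologicalSpace τ.Flag := τ.chartCore.toTopologicalSpace

noncomputable instance : ChartedSpace (τ.Idx → ℂ) τ.Flag := τ.chartCore.toChartedSpace

/-- The chart inverse to `B ↦ g (1 + B) · F₀`, as a local homeomorphism. -/
noncomputable def cellHomeo (g : GL (Fin N) ℂ) : OpenPartialHomeomorph τ.Flag (τ.Idx → ℂ) :=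
  τ.chartCore.openPartialHomeomorph (τ.cellChart g) ⟨g, rfl⟩

theorem mem_atlas_iff {e : OpenPartialHomeomorph τ.Flag (τ.Idx → ℂ)} :
    e ∈ atlas (τ.Idx → ℂ) τ.Flag ↔ ∃ g, e = τ.cellHomeo g := by
  constructor
  · intro he
    obtain ⟨_, ⟨f, rfl⟩, he⟩ := he
    obtain ⟨_, ⟨⟨g, rfl⟩, rfl⟩, he⟩ := he
    exact ⟨g, he⟩
  · rintro ⟨g, rfl⟩
    exact Set.mem_iUnion.2 ⟨τ.cellChart g, Set.mem_iUnion.2 ⟨⟨g, rfl⟩, rfl⟩⟩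

/-- `X` is a complex manifold. -/
instance : IsManifold 𝓘(ℂ, τ.Idx → ℂ) ω τ.Flag := by
  refine isManifold_of_contDiffOn _ _ _ ?_
  intro e e' he he'
  obtain ⟨g, rfl⟩ := τ.mem_atlas_iff.1 he
  obtain ⟨g', rfl⟩ := τ.mem_atlas_iff.1 he'
  have hs : ((τ.cellChart g).symm.trans (τ.cellChart g')).source = _ :=
    τ.cellChart_trans_source g g'
  refine ((τ.contDiffOn_coord (τ.contDiff_trans_mat g g'⁻¹)).congr ?_).mono
    (s := {B | τ.InCell (g'⁻¹ * (g * τ.unip B)).1}) ?_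
  · intro B hB
    exact τ.cellChart_trans_apply g g' hB
  · intro B hB
    rw [← hs]
    exact hB.1

end FlagType
section FrameAtlas

variable {EB HB B : Type*} [NormedAddCommGroup EB] [NormedSpace ℂ EB] [TopologicalSpace HB]
  [TopologicalSpace B] [ChartedSpace HB B]

/-- Local frames of a family of vector spaces `E b`, over an open cover of `B`, with holomorphic
transition matrices. (Outside of `U i`, the map `frame i b` is a junk value.) -/
structure FrameAtlas (IB : ModelWithCorners ℂ EB HB) (K : Type) [Fintype K] [DecidableEq K]
    (E : B → Type) [∀ b, AddCommGroup (E b)] [∀ b, Module ℂ (E b)] where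
  ι : Type
  U : ι → Set B
  isOpen_U : ∀ i, IsOpen (U i)
  idxAt : B → ι
  mem_U : ∀ b, b ∈ U (idxAt b)
  frame : ι → ∀ b, E b ≃ₗ[ℂ] (K → ℂ)
  holo : ∀ i j k k', ContMDiffOn IB 𝓘(ℂ, ℂ) ω
    (fun b => frame j b ((frame i b).symm (Pi.single k 1)) k') (U i ∩ U j)

namespace FrameAtlas

variable {IB : ModelWithCorners ℂ EB HB} {K : Type} [Fintype K] [DecidableEq K]
  {E : B → Type} [∀ b, AddCommGroup (E b)] [∀ b, Module ℂ (E b)]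
  (A : FrameAtlas IB K E)

/-- The local trivialization given by a local frame. -/
def pretriv (i : A.ι) : Bundle.Pretrivialization (K → ℂ) (Bundle.TotalSpace.proj
    (F := K → ℂ) (E := E)) where
  toFun x := (x.1, A.frame i x.1 x.2)
  invFun p := ⟨p.1, (A.frame i p.1).symm p.2⟩
  source := Bundle.TotalSpace.proj ⁻¹' A.U i
  target := A.U i ×ˢ Set.univ
  map_source' _ hx := ⟨hx, Set.mem_univ _⟩
  map_target' _ hp := hp.1
  left_inv' x _ := by simp
  right_inv' p _ := by simp
  open_target := (A.isOpen_U i).prod isOpen_univ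
  baseSet := A.U i
  open_baseSet := A.isOpen_U i
  source_eq := rfl
  target_eq := rfl
  proj_toFun _ _ := rfl

/-- The transition map between two local frames. -/
noncomputable def trans (i j : A.ι) (b : B) : (K → ℂ) →L[ℂ] (K → ℂ) :=
  ((A.frame i b).symm ≪≫ₗ A.frame j b).toLinearMap.toContinuousLinearMap

theorem trans_contMDiffOn (i j : A.ι) :
    ContMDiffOn IB 𝓘(ℂ, (K → ℂ) →L[ℂ] (K → ℂ)) ω (A.trans i j) (A.U i ∩ A.U j) := by
  let L : (K → K → ℂ) →ₗ[ℂ] ((K → ℂ) →L[ℂ] (K → ℂ)) :=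
    LinearMap.toContinuousLinearMap.toLinearMap ∘ₗ
      (Matrix.toLin' : Matrix K K ℂ ≃ₗ[ℂ] _).toLinearMap
  have hL : ContDiff ℂ ω L := L.toContinuousLinearMap.contDiff
  have h : A.trans i j = fun b => L (fun k' k =>
      A.frame j b ((A.frame i b).symm (Pi.single k 1)) k') := by
    funext b
    apply ContinuousLinearMap.coe_injective
    refine (Pi.basisFun ℂ K).ext fun k => ?_
    funext k'
    rw [Pi.basisFun_apply]
    have : (Matrix.toLin' (Matrix.of fun k' k =>
        A.frame j b ((A.frame i b).symm (Pi.single k 1)) k')) (Pi.single k 1) k' =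
        A.frame j b ((A.frame i b).symm (Pi.single k 1)) k' := by
      rw [Matrix.toLin'_apply, Matrix.mulVec_single_one]
      rfl
    exact this.symm
  rw [h]
  refine hL.contMDiff.comp_contMDiffOn ?_
  rw [contMDiffOn_pi_space]
  intro k'
  rw [contMDiffOn_pi_space]
  intro k
  exact A.holo i j k k'

theorem trans_apply (i j : A.ι) (b : B) (hb : b ∈ A.U i) (v : K → ℂ) :
    A.trans i j b v = (A.pretriv j ⟨b, (A.pretriv i).symm b v⟩).2 := by
  have h1 : A.pretriv i ⟨b, (A.pretriv i).symm b v⟩ = (b, v) :=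
    (A.pretriv i).apply_mk_symm hb v
  have h2 : A.frame i b ((A.pretriv i).symm b v) = v := congrArg Prod.snd h1
  change A.frame j b ((A.frame i b).symm v) = A.frame j b ((A.pretriv i).symm b v)
  rw [← h2, LinearEquiv.symm_apply_apply, h2]

variable [∀ b, TopologicalSpace (E b)] [∀ b, IsModuleTopology ℂ (E b)]

/-- The vector bundle structure defined by an atlas of local frames. -/
noncomputable def prebundle : VectorPrebundle ℂ (K → ℂ) E where
  pretrivializationAtlas := Set.range A.pretriv
  pretrivialization_linear' := by
    rintro _ ⟨i, rfl⟩
    exact ⟨fun b _ => (A.frame i b).toLinearMap.isLinear⟩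
  pretrivializationAt b := A.pretriv (A.idxAt b)
  mem_base_pretrivializationAt := A.mem_U
  pretrivialization_mem_atlas _ := ⟨_, rfl⟩
  exists_coordChange := by
    rintro _ ⟨i, rfl⟩ _ ⟨j, rfl⟩
    exact ⟨A.trans i j, (A.trans_contMDiffOn i j).continuousOn,
      fun b hb v => A.trans_apply i j b hb.1 v⟩
  totalSpaceMk_isInducing b := by
    have h1 : Continuous (A.frame (A.idxAt b) b) :=
      IsModuleTopology.continuous_of_linearMap (A.frame (A.idxAt b) b).toLinearMap
    have h2 : Continuous (A.frame (A.idxAt b) b).symm := by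
      have : ContinuousAdd (E b) := IsModuleTopology.toContinuousAdd ℂ (E b)
      exact IsModuleTopology.continuous_of_linearMap (A.frame (A.idxAt b) b).symm.toLinearMap
    let e : E b ≃ₜ (K → ℂ) :=
      { (A.frame (A.idxAt b) b).toEquiv with
        continuous_toFun := h1
        continuous_invFun := h2 }
    have h3 : Topology.IsInducing (fun v : K → ℂ => (b, v)) := Topology.isInducing_const_prod.2 .id
    exact h3.comp e.isInducing

instance : A.prebundle.IsContMDiff IB ω where
  exists_contMDiffCoordChange := by
    rintro _ ⟨i, rfl⟩ _ ⟨j, rfl⟩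
    exact ⟨A.trans i j, A.trans_contMDiffOn i j, fun b hb v => A.trans_apply i j b hb.1 v⟩

end FrameAtlas

end FrameAtlas
namespace FlagType

variable {N : ℕ} (τ : FlagType N)

/-- The index `i ∈ {1, …, k-1}` as an element of `{1, …, k}`. -/
def lo (i : Fin (τ.k - 1)) : Fin τ.k := ⟨i, by omega⟩

/-- The index `i ∈ {1, …, k-2}` as an element of `{1, …, k-1}`. -/
def fst (i : Fin (τ.k - 2)) : Fin (τ.k - 1) := ⟨i, by omega⟩

/-- The index `i + 1` for `i ∈ {1, …, k-2}`, as an element of `{1, …, k-1}`. -/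
def snd (i : Fin (τ.k - 2)) : Fin (τ.k - 1) := ⟨i + 1, by omega⟩

theorem lo_fst_le (i : Fin (τ.k - 2)) : τ.lo (τ.fst i) ≤ τ.lo (τ.snd i) :=
  Fin.le_def.2 (Nat.le_succ _)

/-- The fibre at `x` of the tautological bundle `H_i`. -/
abbrev H (i : Fin τ.k) (x : τ.Flag) : Submodule ℂ (Fin N → ℂ) := x.V i

/-- The fibre at `x` of the quotient bundle `F_i = (X × ℂ^N) / H_i`. -/
abbrev F (i : Fin τ.k) (x : τ.Flag) : Type := (Fin N → ℂ) ⧸ τ.H i x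

/-- The projection `q_{i,x} : ℂ^N → F_{i,x}`. -/
abbrev q (i : Fin τ.k) (x : τ.Flag) : (Fin N → ℂ) →ₗ[ℂ] τ.F i x := (τ.H i x).mkQ

/-- The natural map `F_{i,x} → F_{j,x}`, `v + H_i ↦ v + H_j`, for `i ≤ j`. -/
def Q {i j : Fin τ.k} (hij : i ≤ j) (x : τ.Flag) : τ.F i x →ₗ[ℂ] τ.F j x :=
  Submodule.factor (x.mono hij)

/-- The fibre of `⊕_{i=1}^{k-1} Hom(H_{i,ζ}, F_{i,z})` at `p = (z, ζ)`. -/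
def SumHom (p : τ.Flag × τ.Flag) : Type :=
  ∀ i : Fin (τ.k - 1), τ.H (τ.lo i) p.2 →ₗ[ℂ] τ.F (τ.lo i) p.1

noncomputable instance (p : τ.Flag × τ.Flag) : AddCommGroup (τ.SumHom p) :=
  inferInstanceAs (AddCommGroup (∀ i : Fin (τ.k - 1), τ.H (τ.lo i) p.2 →ₗ[ℂ] τ.F (τ.lo i) p.1))

noncomputable instance (p : τ.Flag × τ.Flag) : Module ℂ (τ.SumHom p) :=
  inferInstanceAs (Module ℂ (∀ i : Fin (τ.k - 1), τ.H (τ.lo i) p.2 →ₗ[ℂ] τ.F (τ.lo i) p.1))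

/-- The fibre of `⊕_{i=1}^{k-2} Hom(H_{i,ζ}, F_{i+1,z})` at `p = (z, ζ)`. -/
abbrev SumHomShift (p : τ.Flag × τ.Flag) : Type :=
  ∀ i : Fin (τ.k - 2), τ.H (τ.lo (τ.fst i)) p.2 →ₗ[ℂ] τ.F (τ.lo (τ.snd i)) p.1

/-- `Φ(⊕ f_i) = ⊕ (f_{i+1}|_{H_i} - Q_i ∘ f_i)`. -/
noncomputable def Phi (p : τ.Flag × τ.Flag) : τ.SumHom p →ₗ[ℂ] τ.SumHomShift p where
  toFun f i := f (τ.snd i) ∘ₗ Submodule.inclusion (p.2.mono (τ.lo_fst_le i)) -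
    τ.Q (τ.lo_fst_le i) p.1 ∘ₗ f (τ.fst i)
  map_add' f g := by
    funext i
    refine LinearMap.ext fun v => ?_
    let v' := Submodule.inclusion (p.2.mono (τ.lo_fst_le i)) v
    let T := τ.Q (τ.lo_fst_le i) p.1
    change (f (τ.snd i) v' + g (τ.snd i) v') - T (f (τ.fst i) v + g (τ.fst i) v) =
      (f (τ.snd i) v' - T (f (τ.fst i) v)) + (g (τ.snd i) v' - T (g (τ.fst i) v))
    rw [map_add]
    abel
  map_smul' c f := by
    funext i
    refine LinearMap.ext fun v => ?_
    let v' := Submodule.inclusion (p.2.mono (τ.lo_fst_le i)) v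
    let T := τ.Q (τ.lo_fst_le i) p.1
    change c • f (τ.snd i) v' - T (c • f (τ.fst i) v) =
      c • (f (τ.snd i) v' - T (f (τ.fst i) v))
    rw [map_smul, smul_sub]

/-- The fibre of `E = ker Φ` at `p = (z, ζ)`. -/
def E (p : τ.Flag × τ.Flag) : Type := LinearMap.ker (τ.Phi p)

noncomputable instance (p : τ.Flag × τ.Flag) : AddCommGroup (τ.E p) :=
  inferInstanceAs (AddCommGroup (LinearMap.ker (τ.Phi p)))

noncomputable instance (p : τ.Flag × τ.Flag) : Module ℂ (τ.E p) :=
  inferInstanceAs (Module ℂ (LinearMap.ker (τ.Phi p)))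

/-- The inclusion `E ⊆ ⊕ Hom(H_{i,ζ}, F_{i,z})` in the fibre over `p`. -/
noncomputable def incl (p : τ.Flag × τ.Flag) : τ.E p →ₗ[ℂ] τ.SumHom p :=
  (LinearMap.ker (τ.Phi p)).subtype

/-! The fibres are finite-dimensional complex vector spaces; they carry their usual topology. -/

noncomputable instance (p : τ.Flag × τ.Flag) : TopologicalSpace (τ.SumHom p) :=
  moduleTopology ℂ (τ.SumHom p)

instance (p : τ.Flag × τ.Flag) : IsModuleTopology ℂ (τ.SumHom p) := ⟨rfl⟩

noncomputable instance (p : τ.Flag × τ.Flag) : TopologicalSpace (τ.E p) :=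
  moduleTopology ℂ (τ.E p)

instance (p : τ.Flag × τ.Flag) : IsModuleTopology ℂ (τ.E p) := ⟨rfl⟩

/-! ### Frames of the fibres -/

section Frame

variable {τ} {x : τ.Flag} {g : GL (Fin N) ℂ}

theorem mem_of_orbit (hx : τ.orbit g = x) {i : Fin τ.k} {v : Fin N → ℂ} :
    v ∈ x.V i ↔ ∀ a : Fin N, τ.d i ≤ a → ((g⁻¹).1 *ᵥ v) a = 0 := by
  rw [← hx, mem_orbit]

theorem mulVec_inv_mulVec (g : GL (Fin N) ℂ) (v : Fin N → ℂ) : (g⁻¹).1 *ᵥ (g.1 *ᵥ v) = v :=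
  (glEquiv g).symm_apply_apply v

theorem mulVec_mulVec_inv (g : GL (Fin N) ℂ) (v : Fin N → ℂ) : g.1 *ᵥ ((g⁻¹).1 *ᵥ v) = v :=
  (glEquiv g).apply_symm_apply v

/-- The frame `g e_c`, `c < d_i`, of the fibre of `H_i` at `x = g · F₀`. -/
noncomputable def hvec (hx : τ.orbit g = x) (i : Fin τ.k) (c : Fin N) (hc : (c : ℕ) < τ.d i) :
    τ.H i x :=
  ⟨g.1 *ᵥ Pi.single c 1, (mem_of_orbit hx).2 (by
    intro a ha
    rw [mulVec_inv_mulVec, Pi.single_eq_of_ne]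
    rintro rfl
    omega)⟩

/-- The coordinates `v + H_i ↦ (g⁻¹ v)_a`, `a ≥ d_i`, on the fibre of `F_i` at `x = g · F₀`. -/
noncomputable def qcoord (hx : τ.orbit g = x) (i : Fin τ.k) (a : Fin N) (ha : τ.d i ≤ (a : ℕ)) :
    τ.F i x →ₗ[ℂ] ℂ :=
  (τ.H i x).liftQ (LinearMap.proj a ∘ₗ (glEquiv g).symm.toLinearMap) (by
    intro v hv
    exact (mem_of_orbit hx).1 hv a ha)

theorem qcoord_mk (hx : τ.orbit g = x) (i : Fin τ.k) (a : Fin N) (ha : τ.d i ≤ (a : ℕ))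
    (v : Fin N → ℂ) : qcoord hx i a ha (τ.q i x v) = ((g⁻¹).1 *ᵥ v) a := rfl

theorem qcoord_ext (hx : τ.orbit g = x) {i : Fin τ.k} {y : τ.F i x}
    (h : ∀ a ha, qcoord hx i a ha y = 0) : y = 0 := by
  obtain ⟨v, rfl⟩ := Submodule.mkQ_surjective _ y
  rw [Submodule.mkQ_apply, Submodule.Quotient.mk_eq_zero]
  exact (mem_of_orbit hx).2 h

theorem qcoord_Q (hx : τ.orbit g = x) {i j : Fin τ.k} (hij : i ≤ j) (a : Fin N)
    (ha : τ.d j ≤ (a : ℕ)) (y : τ.F i x) :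
    qcoord hx j a ha (τ.Q hij x y) = qcoord hx i a ((τ.mono hij).trans ha) y := by
  obtain ⟨v, rfl⟩ := Submodule.mkQ_surjective _ y
  rfl

theorem hom_ext (hx : τ.orbit g = x) {i : Fin τ.k} {W : Type} [AddCommGroup W] [Module ℂ W]
    {f : τ.H i x →ₗ[ℂ] W} (h : ∀ c hc, f (hvec hx i c hc) = 0) : f = 0 := by
  ext1 ⟨v, hv⟩
  have hu := (mem_of_orbit hx).1 hv
  have : (⟨v, hv⟩ : τ.H i x) = ∑ c : Fin N,
      if hc : (c : ℕ) < τ.d i then ((g⁻¹).1 *ᵥ v) c • hvec hx i c hc else 0 := by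
    apply Subtype.ext
    rw [AddSubmonoidClass.coe_finsetSum]
    have h1 : ∀ c : Fin N, ((if hc : (c : ℕ) < τ.d i then ((g⁻¹).1 *ᵥ v) c • hvec hx i c hc else 0
        : τ.H i x) : Fin N → ℂ) = glEquiv g (((g⁻¹).1 *ᵥ v) c • Pi.single c 1) := by
      intro c
      by_cases hc : (c : ℕ) < τ.d i
      · rw [dif_pos hc, map_smul]
        rfl
      · rw [dif_neg hc, hu c (not_lt.1 hc), zero_smul, map_zero]
        rfl
    simp only [h1]
    rw [← map_sum]
    have h2 : ∑ c, ((g⁻¹).1 *ᵥ v) c • (Pi.single c 1 : Fin N → ℂ) = (g⁻¹).1 *ᵥ v := by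
      have := pi_eq_sum_univ' ((g⁻¹).1 *ᵥ v)
      conv_rhs => rw [this]
    rw [h2, glEquiv_apply, mulVec_mulVec_inv]
  rw [this, map_sum, LinearMap.zero_apply]
  refine Finset.sum_eq_zero fun c _ => ?_
  by_cases hc : (c : ℕ) < τ.d i
  · rw [dif_pos hc, map_smul, h, smul_zero]
  · rw [dif_neg hc, map_zero]

end Frame

/-- The triples `(i, a, c)` with `c < d_i ≤ a`, which index the matrix entries of elements of
`⊕_{i=1}^{k-1} Hom(H_{i,ζ}, F_{i,z})`. -/
abbrev SumIdx : Type :=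
  {t : Fin (τ.k - 1) × Fin N × Fin N //
    (t.2.2 : ℕ) < τ.d (τ.lo t.1) ∧ τ.d (τ.lo t.1) ≤ (t.2.1 : ℕ)}

variable {τ}

/-- The `i`-th block of a family of matrix entries. -/
noncomputable def block (w : τ.SumIdx → ℂ) (i : Fin (τ.k - 1)) : Matrix (Fin N) (Fin N) ℂ :=
  Matrix.of fun a c => if h : _ then w ⟨(i, a, c), h⟩ else 0

section Frame

variable {z ζ : τ.Flag} {g h : GL (Fin N) ℂ}

/-- The matrix entries of `f ∈ ⊕ Hom(H_{i,ζ}, F_{i,z})` for `z = g · F₀`, `ζ = h · F₀`, with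
respect to the frame `h e_c` of `H_{i,ζ}` and the frame of `F_{i,z}` formed by the classes of the
`g e_a`. -/
noncomputable def sumCoord (hz : τ.orbit g = z) (hζ : τ.orbit h = ζ) :
    τ.SumHom (z, ζ) →ₗ[ℂ] (τ.SumIdx → ℂ) where
  toFun f t := qcoord hz (τ.lo t.1.1) t.1.2.1 t.2.2 (f t.1.1 (hvec hζ (τ.lo t.1.1) t.1.2.2 t.2.1))
  map_add' f f' := by
    funext t
    exact map_add (qcoord hz (τ.lo t.1.1) t.1.2.1 t.2.2) _ _
  map_smul' c f := by
    funext t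
    exact map_smul (qcoord hz (τ.lo t.1.1) t.1.2.1 t.2.2) _ _

/-- The element of `⊕ Hom(H_{i,ζ}, F_{i,z})` with given matrix entries. -/
noncomputable def sumOfCoord (z ζ : τ.Flag) (g h : GL (Fin N) ℂ) (w : τ.SumIdx → ℂ) :
    τ.SumHom (z, ζ) :=
  fun i => τ.q (τ.lo i) z ∘ₗ Matrix.toLin' (g.1 * block w i * (h⁻¹).1) ∘ₗ (τ.H (τ.lo i) ζ).subtype

theorem sumCoord_sumOfCoord (hz : τ.orbit g = z) (hζ : τ.orbit h = ζ) (g' h' : GL (Fin N) ℂ)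
    (w : τ.SumIdx → ℂ) (t : τ.SumIdx) :
    sumCoord hz hζ (sumOfCoord z ζ g' h' w) t =
      ((g⁻¹).1 * (g'.1 * block w t.1.1 * (h'⁻¹).1) * h.1) t.1.2.1 t.1.2.2 := by
  change ((g⁻¹).1 *ᵥ ((g'.1 * block w t.1.1 * (h'⁻¹).1) *ᵥ (h.1 *ᵥ Pi.single t.1.2.2 1))) t.1.2.1 = _
  rw [Matrix.mulVec_mulVec, Matrix.mulVec_mulVec, Matrix.mulVec_single_one, ← Matrix.mul_assoc]
  rfl

theorem sumCoord_sumOfCoord_self (hz : τ.orbit g = z) (hζ : τ.orbit h = ζ) (w : τ.SumIdx → ℂ) :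
    sumCoord hz hζ (sumOfCoord z ζ g h w) = w := by
  funext t
  rw [sumCoord_sumOfCoord]
  have h1 : (g⁻¹).1 * (g.1 * block w t.1.1 * (h⁻¹).1) * h.1 = block w t.1.1 := by
    have e1 : (g⁻¹).1 * g.1 = 1 := by rw [← Units.val_mul, inv_mul_cancel]; rfl
    have e2 : (h⁻¹).1 * h.1 = 1 := by rw [← Units.val_mul, inv_mul_cancel]; rfl
    calc _ = ((g⁻¹).1 * g.1) * block w t.1.1 * ((h⁻¹).1 * h.1) := by simp only [Matrix.mul_assoc]
      _ = _ := by rw [e1, e2, Matrix.one_mul, Matrix.mul_one]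
  rw [h1]
  exact dif_pos t.2

theorem sumCoord_injective (hz : τ.orbit g = z) (hζ : τ.orbit h = ζ) :
    Function.Injective (sumCoord hz hζ) := by
  rw [← LinearMap.ker_eq_bot, LinearMap.ker_eq_bot']
  intro f hf
  funext i
  refine hom_ext hζ fun c hc => qcoord_ext hz fun a ha => ?_
  exact congrFun hf ⟨(i, a, c), hc, ha⟩

/-- The frame of `⊕ Hom(H_{i,ζ}, F_{i,z})` given by `z = g · F₀`, `ζ = h · F₀`. -/
noncomputable def sumFrame (hz : τ.orbit g = z) (hζ : τ.orbit h = ζ) :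
    τ.SumHom (z, ζ) ≃ₗ[ℂ] (τ.SumIdx → ℂ) :=
  { sumCoord hz hζ with
    invFun := sumOfCoord z ζ g h
    left_inv := fun _ => sumCoord_injective hz hζ (sumCoord_sumOfCoord_self hz hζ _)
    right_inv := sumCoord_sumOfCoord_self hz hζ }

theorem mem_ker_Phi_iff (hz : τ.orbit g = z) (hζ : τ.orbit h = ζ) (f : τ.SumHom (z, ζ)) :
    τ.Phi (z, ζ) f = 0 ↔ ∀ (i : Fin (τ.k - 2)) (a c : Fin N)
      (h1 : (c : ℕ) < τ.d (τ.lo (τ.fst i))) (h2 : τ.d (τ.lo (τ.snd i)) ≤ (a : ℕ)),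
      sumCoord hz hζ f ⟨(τ.snd i, a, c), h1.trans_le (τ.mono (τ.lo_fst_le i)), h2⟩ =
        sumCoord hz hζ f ⟨(τ.fst i, a, c), h1, (τ.mono (τ.lo_fst_le i)).trans h2⟩ := by
  have key : ∀ (i : Fin (τ.k - 2)) (a c : Fin N)
      (h1 : (c : ℕ) < τ.d (τ.lo (τ.fst i))) (h2 : τ.d (τ.lo (τ.snd i)) ≤ (a : ℕ)),
      qcoord hz _ a h2 (τ.Phi (z, ζ) f i (hvec hζ _ c h1)) =
      sumCoord hz hζ f ⟨(τ.snd i, a, c), h1.trans_le (τ.mono (τ.lo_fst_le i)), h2⟩ -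
        sumCoord hz hζ f ⟨(τ.fst i, a, c), h1, (τ.mono (τ.lo_fst_le i)).trans h2⟩ := by
    intro i a c h1 h2
    have : τ.Phi (z, ζ) f i (hvec hζ _ c h1) =
        f (τ.snd i) (hvec hζ _ c (h1.trans_le (τ.mono (τ.lo_fst_le i)))) -
          τ.Q (τ.lo_fst_le i) z (f (τ.fst i) (hvec hζ _ c h1)) := rfl
    rw [this, map_sub, qcoord_Q]
    rfl
  constructor
  · intro hf i a c h1 h2
    rw [← sub_eq_zero, ← key i a c h1 h2, hf]
    exact map_zero _
  · intro hf
    funext i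
    refine hom_ext hζ fun c h1 => qcoord_ext hz fun a h2 => ?_
    rw [key i a c h1 h2, hf i a c h1 h2, sub_self]

theorem sumCoord_eq (hz : τ.orbit g = z) (hζ : τ.orbit h = ζ) {f : τ.SumHom (z, ζ)}
    (hf : τ.Phi (z, ζ) f = 0) {i j : Fin (τ.k - 1)} {a c : Fin N}
    (hi : (c : ℕ) < τ.d (τ.lo i) ∧ τ.d (τ.lo i) ≤ (a : ℕ))
    (hj : (c : ℕ) < τ.d (τ.lo j) ∧ τ.d (τ.lo j) ≤ (a : ℕ)) :
    sumCoord hz hζ f ⟨(i, a, c), hi⟩ = sumCoord hz hζ f ⟨(j, a, c), hj⟩ := by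
  rw [mem_ker_Phi_iff hz hζ] at hf
  have key : ∀ n : ℕ, ∀ i j : Fin (τ.k - 1), (j : ℕ) = i + n →
      ∀ (hi : (c : ℕ) < τ.d (τ.lo i) ∧ τ.d (τ.lo i) ≤ (a : ℕ))
        (hj : (c : ℕ) < τ.d (τ.lo j) ∧ τ.d (τ.lo j) ≤ (a : ℕ)),
      sumCoord hz hζ f ⟨(i, a, c), hi⟩ = sumCoord hz hζ f ⟨(j, a, c), hj⟩ := by
    intro n
    induction n with
    | zero =>
      intro i j hij hi hj
      have : i = j := Fin.ext hij.symm
      subst this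
      rfl
    | succ n ih =>
      intro i j hij hi hj
      have hlt : (i : ℕ) + n < τ.k - 2 := by have := j.2; omega
      let m : Fin (τ.k - 2) := ⟨i + n, hlt⟩
      have hjm : j = τ.snd m := Fin.ext hij
      subst hjm
      have h1 : (c : ℕ) < τ.d (τ.lo (τ.fst m)) :=
        hi.1.trans_le (τ.mono (Fin.le_def.2 (Nat.le_add_right _ _)))
      have h2 := ih i (τ.fst m) rfl hi ⟨h1, (τ.mono (τ.lo_fst_le m)).trans hj.2⟩
      rw [h2, ← hf m a c h1 hj.2]
  rcases le_total (i : ℕ) j with hij | hij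
  · exact key (j - i) i j (by omega) hi hj
  · exact (key (i - j) j i (by omega) hj hi).symm

theorem exists_lo (q : τ.Idx) : ∃ i : Fin (τ.k - 1),
    (q.1.2 : ℕ) < τ.d (τ.lo i) ∧ τ.d (τ.lo i) ≤ (q.1.1 : ℕ) := by
  obtain ⟨⟨a, c⟩, i, h1, h2⟩ := q
  have hi : (i : ℕ) < τ.k - 1 := by
    by_contra hcon
    have : i = ⟨τ.k - 1, Nat.sub_lt τ.k_pos Nat.one_pos⟩ :=
      Fin.ext (by have := i.2; simp only; omega)
    have h3 := τ.d_last
    rw [← this] at h3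
    have := a.2
    simp only at h2
    omega
  exact ⟨⟨i, hi⟩, h1, h2⟩

/-- The triple `(i, a, c)`, for some `i`, defined by a pair `(a, c)`. -/
noncomputable def toSumIdx (q : τ.Idx) : τ.SumIdx :=
  ⟨((exists_lo q).choose, q.1.1, q.1.2), (exists_lo q).choose_spec⟩

/-- The pair `(a, c)` of a triple `(i, a, c)`. -/
def toIdx (t : τ.SumIdx) : τ.Idx := ⟨(t.1.2.1, t.1.2.2), τ.lo t.1.1, t.2⟩

/-- The frame of `E` given by `z = g · F₀`, `ζ = h · F₀`: an element `f` of `E` is determined by its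
matrix entries, and those with the same `(a, c)` agree. -/
noncomputable def kerFrame (hz : τ.orbit g = z) (hζ : τ.orbit h = ζ) :
    τ.E (z, ζ) ≃ₗ[ℂ] (τ.Idx → ℂ) where
  toFun f q := sumFrame hz hζ (τ.incl (z, ζ) f) (toSumIdx q)
  map_add' f f' := by
    funext q
    rw [map_add, map_add]
    rfl
  map_smul' c f := by
    funext q
    rw [map_smul, map_smul]
    rfl
  invFun w := ⟨(sumFrame hz hζ).symm (w ∘ toIdx), by
    rw [LinearMap.mem_ker, mem_ker_Phi_iff hz hζ]
    intro i a c h1 h2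
    have : sumCoord hz hζ ((sumFrame hz hζ).symm (w ∘ toIdx)) = w ∘ toIdx :=
      (sumFrame hz hζ).apply_symm_apply _
    rw [this]
    rfl⟩
  left_inv f := by
    refine Subtype.ext ((LinearEquiv.symm_apply_eq _).2 ?_)
    funext t
    exact sumCoord_eq hz hζ f.2 _ _
  right_inv w := by
    funext q
    change sumFrame hz hζ ((sumFrame hz hζ).symm (w ∘ toIdx)) (toSumIdx q) = w q
    rw [LinearEquiv.apply_symm_apply]
    rfl

end Frame

/-! ### Holomorphic structure -/

variable (τ)

/-- A local section `x ↦ s(x)` of `GL(N, ℂ) → X`, `g ↦ g · F₀`, over the cell around `g · F₀`. -/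
noncomputable def lift (g : GL (Fin N) ℂ) (x : τ.Flag) : GL (Fin N) ℂ :=
  open Classical in
  if x ∈ (τ.cellHomeo g).source then g * τ.unip (τ.cellHomeo g x) else τ.frameAt x

theorem orbit_lift (g : GL (Fin N) ℂ) (x : τ.Flag) : τ.orbit (τ.lift g x) = x := by
  rw [lift]
  split_ifs with hx
  · exact (τ.cellHomeo g).left_inv hx
  · exact τ.orbit_frameAt x

section ContMDiff

variable {EB HB B : Type*} [NormedAddCommGroup EB] [NormedSpace ℂ EB] [TopologicalSpace HB]
  [TopologicalSpace B] [ChartedSpace HB B] {IB : ModelWithCorners ℂ EB HB}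

theorem contMDiffOn_mul {M M' : B → Matrix (Fin N) (Fin N) ℂ} {s : Set B}
    (h : ∀ a c, ContMDiffOn IB 𝓘(ℂ, ℂ) ω (fun x => M x a c) s)
    (h' : ∀ a c, ContMDiffOn IB 𝓘(ℂ, ℂ) ω (fun x => M' x a c) s)
    (a c : Fin N) : ContMDiffOn IB 𝓘(ℂ, ℂ) ω (fun x => (M x * M' x) a c) s := by
  have hP : ContDiff ℂ ω fun y : (Fin N → ℂ) × (Fin N → ℂ) => ∑ b, y.1 b * y.2 b := by
    refine ContDiff.sum fun b _ => ContDiff.mul ?_ ?_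
    · exact (contDiff_apply ℂ ℂ b).comp contDiff_fst
    · exact (contDiff_apply ℂ ℂ b).comp contDiff_snd
  have h1 : ContMDiffOn IB 𝓘(ℂ, (Fin N → ℂ) × (Fin N → ℂ)) ω
      (fun x => (fun b => M x a b, fun b => M' x b c)) s :=
    (contMDiffOn_pi_space.2 fun b => h a b).prodMk_space (contMDiffOn_pi_space.2 fun b => h' b c)
  exact hP.contMDiff.comp_contMDiffOn h1

theorem contMDiffOn_lift (g : GL (Fin N) ℂ) (a c : Fin N) :
    ContMDiffOn 𝓘(ℂ, τ.Idx → ℂ) 𝓘(ℂ, ℂ) ω (fun x => (τ.lift g x).1 a c)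
      (τ.cellHomeo g).source := by
  have hchart := contMDiffOn_of_mem_maximalAtlas (I := 𝓘(ℂ, τ.Idx → ℂ)) (n := ω)
    (IsManifold.subset_maximalAtlas (τ.mem_atlas_iff.2 ⟨g, rfl⟩))
  have h1 : ContDiff ℂ ω fun B : τ.Idx → ℂ => (g * τ.unip B).1 a c := by
    simpa using τ.contDiff_trans_mat g 1 a c
  refine (h1.contMDiff.comp_contMDiffOn hchart).congr ?_
  intro x hx
  simp [lift, hx]

theorem contMDiffOn_lift_inv (g : GL (Fin N) ℂ) (a c : Fin N) :
    ContMDiffOn 𝓘(ℂ, τ.Idx → ℂ) 𝓘(ℂ, ℂ) ω (fun x => ((τ.lift g x)⁻¹).1 a c)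
      (τ.cellHomeo g).source := by
  have hchart := contMDiffOn_of_mem_maximalAtlas (I := 𝓘(ℂ, τ.Idx → ℂ)) (n := ω)
    (IsManifold.subset_maximalAtlas (τ.mem_atlas_iff.2 ⟨g, rfl⟩))
  have h0 : ∀ a c, ContDiff ℂ ω fun B : τ.Idx → ℂ => (g * τ.unip B).1 a c := by
    simpa using τ.contDiff_trans_mat g 1
  have h1 : ContDiff ℂ ω fun B : τ.Idx → ℂ => ((g * τ.unip B)⁻¹).1 a c := by
    have := contDiffOn_inv h0 (s := Set.univ) (fun B _ => ?_) a c
    · rw [contDiffOn_univ] at this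
      simpa only [Matrix.coe_units_inv] using this
    · exact ((Matrix.isUnit_iff_isUnit_det _).1 (g * τ.unip B).isUnit).ne_zero
  refine (h1.contMDiff.comp_contMDiffOn hchart).congr ?_
  intro x hx
  simp [lift, hx]

end ContMDiff

theorem mem_cellHomeo_frameAt (x : τ.Flag) : x ∈ (τ.cellHomeo (τ.frameAt x)).source :=
  τ.mem_cell_frameAt x

/-- The cells in `X × X`. -/
def cellProd (i : GL (Fin N) ℂ × GL (Fin N) ℂ) : Set (τ.Flag × τ.Flag) :=
  (τ.cellHomeo i.1).source ×ˢ (τ.cellHomeo i.2).source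

theorem isOpen_cellProd (i : GL (Fin N) ℂ × GL (Fin N) ℂ) : IsOpen (τ.cellProd i) :=
  (τ.cellHomeo i.1).open_source.prod (τ.cellHomeo i.2).open_source

theorem contMDiffOn_entry (i j : GL (Fin N) ℂ × GL (Fin N) ℂ) (W : Matrix (Fin N) (Fin N) ℂ)
    (a c : Fin N) :
    ContMDiffOn (𝓘(ℂ, τ.Idx → ℂ).prod 𝓘(ℂ, τ.Idx → ℂ)) 𝓘(ℂ, ℂ) ω
      (fun p : τ.Flag × τ.Flag => (((τ.lift j.1 p.1)⁻¹).1 *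
        ((τ.lift i.1 p.1).1 * W * ((τ.lift i.2 p.2)⁻¹).1) * (τ.lift j.2 p.2).1) a c)
      (τ.cellProd i ∩ τ.cellProd j) := by
  refine contMDiffOn_mul (contMDiffOn_mul ?_ (contMDiffOn_mul (contMDiffOn_mul ?_ ?_) ?_)) ?_ a c
  · intro a c
    exact (τ.contMDiffOn_lift_inv j.1 a c).comp contMDiffOn_fst fun p hp => hp.2.1
  · intro a c
    exact (τ.contMDiffOn_lift i.1 a c).comp contMDiffOn_fst fun p hp => hp.1.1
  · intro a c
    exact contMDiffOn_const
  · intro a c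
    exact (τ.contMDiffOn_lift_inv i.2 a c).comp contMDiffOn_snd fun p hp => hp.1.2
  · intro a c
    exact (τ.contMDiffOn_lift j.2 a c).comp contMDiffOn_snd fun p hp => hp.2.2

open Classical in
/-- The holomorphic structure of `⊕ Hom(H_{i,ζ}, F_{i,z})`, defined by the holomorphic frames
`s(ζ) e_c` of `H_{i,ζ}` and `q_{i,z}(s(z) e_a)` of `F_{i,z}`, where `s` is a holomorphic local
section of `GL(N, ℂ) → X`. -/
noncomputable def sumAtlas :
    FrameAtlas (𝓘(ℂ, τ.Idx → ℂ).prod 𝓘(ℂ, τ.Idx → ℂ)) τ.SumIdx τ.SumHom where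
  ι := GL (Fin N) ℂ × GL (Fin N) ℂ
  U := τ.cellProd
  isOpen_U := τ.isOpen_cellProd
  idxAt p := (τ.frameAt p.1, τ.frameAt p.2)
  mem_U p := ⟨τ.mem_cellHomeo_frameAt p.1, τ.mem_cellHomeo_frameAt p.2⟩
  frame i p := sumFrame (τ.orbit_lift i.1 p.1) (τ.orbit_lift i.2 p.2)
  holo i j t t' := by
    refine (τ.contMDiffOn_entry i j (block (Pi.single t 1) t'.1.1) t'.1.2.1 t'.1.2.2).congr ?_
    intro p _
    exact sumCoord_sumOfCoord _ _ _ _ _ _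

open Classical in
/-- The holomorphic structure of `E`, defined by the same frames. -/
noncomputable def kerAtlas :
    FrameAtlas (𝓘(ℂ, τ.Idx → ℂ).prod 𝓘(ℂ, τ.Idx → ℂ)) τ.Idx τ.E where
  ι := GL (Fin N) ℂ × GL (Fin N) ℂ
  U := τ.cellProd
  isOpen_U := τ.isOpen_cellProd
  idxAt p := (τ.frameAt p.1, τ.frameAt p.2)
  mem_U p := ⟨τ.mem_cellHomeo_frameAt p.1, τ.mem_cellHomeo_frameAt p.2⟩
  frame i p := kerFrame (τ.orbit_lift i.1 p.1) (τ.orbit_lift i.2 p.2)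
  holo i j t t' := by
    refine (τ.contMDiffOn_entry i j (block (Pi.single t 1 ∘ toIdx) (toSumIdx t').1.1)
      (toSumIdx t').1.2.1 (toSumIdx t').1.2.2).congr ?_
    intro p _
    exact sumCoord_sumOfCoord (τ.orbit_lift j.1 p.1) (τ.orbit_lift j.2 p.2) _ _ _ _

noncomputable instance : TopologicalSpace (Bundle.TotalSpace (τ.SumIdx → ℂ) τ.SumHom) :=
  τ.sumAtlas.prebundle.totalSpaceTopology

noncomputable instance : FiberBundle (τ.SumIdx → ℂ) τ.SumHom := τ.sumAtlas.prebundle.toFiberBundle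

instance : VectorBundle ℂ (τ.SumIdx → ℂ) τ.SumHom := τ.sumAtlas.prebundle.toVectorBundle

/-- `⊕ Hom(H_{i,ζ}, F_{i,z})` is a holomorphic vector bundle over `X × X`. -/
instance : ContMDiffVectorBundle ω (τ.SumIdx → ℂ) τ.SumHom
    (𝓘(ℂ, τ.Idx → ℂ).prod 𝓘(ℂ, τ.Idx → ℂ)) :=
  τ.sumAtlas.prebundle.contMDiffVectorBundle _

noncomputable instance : TopologicalSpace (Bundle.TotalSpace (τ.Idx → ℂ) τ.E) :=
  τ.kerAtlas.prebundle.totalSpaceTopology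

noncomputable instance : FiberBundle (τ.Idx → ℂ) τ.E := τ.kerAtlas.prebundle.toFiberBundle

instance : VectorBundle ℂ (τ.Idx → ℂ) τ.E := τ.kerAtlas.prebundle.toVectorBundle

/-- `E` is a holomorphic vector bundle over `X × X`. -/
instance : ContMDiffVectorBundle ω (τ.Idx → ℂ) τ.E
    (𝓘(ℂ, τ.Idx → ℂ).prod 𝓘(ℂ, τ.Idx → ℂ)) :=
  τ.kerAtlas.prebundle.contMDiffVectorBundle _

/-- The section `η = Σ η_i` of `⊕ Hom(H_{i,ζ}, F_{i,z})`: `η_i(z, ζ) v = q_{i,z}(v)`, for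
`v ∈ H_{i,ζ}`. -/
noncomputable def eta (p : τ.Flag × τ.Flag) : τ.SumHom p :=
  fun i => τ.q (τ.lo i) p.1 ∘ₗ (τ.H (τ.lo i) p.2).subtype

theorem Phi_eta (p : τ.Flag × τ.Flag) : τ.Phi p (τ.eta p) = 0 := by
  funext i
  refine LinearMap.ext fun v => ?_
  exact sub_self (τ.q (τ.lo (τ.snd i)) p.1 v)

/-- The section `η`, as a section of `E`. -/
noncomputable def etaE (p : τ.Flag × τ.Flag) : τ.E p := ⟨τ.eta p, τ.Phi_eta p⟩

/-- `n = Σ_{j=1}^{k-1} d_j (d_{j+1} - d_j)`. -/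
def n : ℕ := ∑ i : Fin (τ.k - 1), τ.d (τ.lo i) * (τ.d ⟨i + 1, by omega⟩ - τ.d (τ.lo i))

end FlagType
section DiagonalProperty

variable {H M : Type*} [NormedAddCommGroup H] [NormedSpace ℂ H] [TopologicalSpace M]
  [ChartedSpace H M]

/-- The section `s` of a holomorphic vector bundle over `M × M` vanishes to first order at `p`:
`s p = 0` and the differentials at `p` of the components of `s` in a local frame are linearly
independent, i.e. the derivative at `p` of `s` in a local trivialization is onto. -/
def VanishesToFirstOrderAt (F : Type*) [NormedAddCommGroup F] [NormedSpace ℂ F]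
    {V : M × M → Type*} [∀ p, AddCommGroup (V p)] [∀ p, Module ℂ (V p)]
    [∀ p, TopologicalSpace (V p)] [TopologicalSpace (Bundle.TotalSpace F V)] [FiberBundle F V]
    (s : ∀ p, V p) (p : M × M) : Prop :=
  s p = 0 ∧ Function.Surjective (mfderiv (𝓘(ℂ, H).prod 𝓘(ℂ, H)) 𝓘(ℂ, F)
    (fun x => (trivializationAt F V p ⟨x, s x⟩).2) p)

/-- The section `s` defines the diagonal of `M × M`: it vanishes to first order along the diagonal
and is non-zero elsewhere. -/
def DefinesDiagonal (F : Type*) [NormedAddCommGroup F] [NormedSpace ℂ F]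
    {V : M × M → Type*} [∀ p, AddCommGroup (V p)] [∀ p, Module ℂ (V p)]
    [∀ p, TopologicalSpace (V p)] [TopologicalSpace (Bundle.TotalSpace F V)] [FiberBundle F V]
    (s : ∀ p, V p) : Prop :=
  (∀ p : M × M, p.1 = p.2 → VanishesToFirstOrderAt (H := H) F s p) ∧
    ∀ p : M × M, p.1 ≠ p.2 → s p ≠ 0

/-- The section `s` is holomorphic. -/
def HolomorphicSection (F : Type*) [NormedAddCommGroup F] [NormedSpace ℂ F]
    {V : M × M → Type*} [∀ p, TopologicalSpace (V p)] [TopologicalSpace (Bundle.TotalSpace F V)]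
    [∀ p, AddCommGroup (V p)] [∀ p, Module ℂ (V p)] [FiberBundle F V]
    (s : ∀ p, V p) : Prop :=
  ContMDiff (𝓘(ℂ, H).prod 𝓘(ℂ, H)) ((𝓘(ℂ, H).prod 𝓘(ℂ, H)).prod 𝓘(ℂ, F)) ω
    fun p => (⟨p, s p⟩ : Bundle.TotalSpace F V)

variable (H M) in
/-- The Diagonal Property of a complex manifold `M` modelled on `H`: over `M × M` there are a
holomorphic vector bundle of rank `dim M` and a holomorphic section of it which vanishes to first
order on the diagonal and is non-zero elsewhere. -/
def HasDiagonalProperty : Prop :=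
  ∃ (F : Type) (_ : NormedAddCommGroup F) (_ : NormedSpace ℂ F)
    (V : M × M → Type) (_ : ∀ p, AddCommGroup (V p)) (_ : ∀ p, Module ℂ (V p))
    (_ : ∀ p, TopologicalSpace (V p)) (_ : TopologicalSpace (Bundle.TotalSpace F V))
    (_ : FiberBundle F V) (_ : VectorBundle ℂ F V),
    ContMDiffVectorBundle ω F V (𝓘(ℂ, H).prod 𝓘(ℂ, H)) ∧
    FiniteDimensional ℂ F ∧ finrank ℂ F = finrank ℂ H ∧
    ∃ s : ∀ p, V p, HolomorphicSection (H := H) F s ∧ DefinesDiagonal (H := H) F s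

end DiagonalProperty

/-! Everything is read off from matrices. Write `z = g · F₀` and `ζ = h · F₀` with `F₀` the standard
flag. The vectors `h e_c`, `c < d_i`, form a basis of `H_{i,ζ}`, and the classes of `g e_a`, `a ≥
d_i`, form a basis of `F_{i,z}`. An element of the big Hom bundle is thus a family of entries `(i,
a, c)` with `c < d_i ≤ a`, and `Φ` takes the difference of the entries `(i + 1, a, c)` and `(i, a,
c)` wherever both exist. For fixed `(a, c)` the admissible `i` form an interval, so on the kernel an
entry depends on `(a, c)` alone (`sumCoord_eq`). Hence `E` has one coordinate for each position in
the strictly lower block triangular matrices `𝔫` (`kerFrame`). These positions also index the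
coordinates of a cell `B ↦ g(1 + B) · F₀` of `X`, so the rank of `E` is `dim X`; `card_idx`
evaluates this number.

Letting `g` and `h` vary holomorphically over cells turns these bases into holomorphic frames. In
them the inclusion of `E` is a constant linear map (`contMDiff_incl`), so `E` is a holomorphic
subbundle.

Each `η_i` is induced by the identity of `ℂ^N`, so the coordinates of `η` are the entries of `g⁻¹h`
at the positions of `𝔫` (`kerFrame_etaE`). They are holomorphic. The section vanishes exactly when
each subspace of `ζ` lies in that of `z`, and equal dimensions then force equality
(`etaE_eq_zero_iff`). For first order vanishing at `(x, x)`, fix `z = x = g · F₀` and let `ζ = g(1 +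
B) · F₀`. Then `g⁻¹h = 1 + B`, so the coordinates of `η` are `B` itself
(`trivializationAt_etaE_cell`). The slice is a holomorphic right inverse of the local expression of
`η`, so the derivative of `η` is onto (`surjective_mfderiv_of_comp_eq_id`). -/

/-- The derivative of a map with a differentiable right inverse is onto. -/
theorem surjective_mfderiv_of_comp_eq_id {EB HB B W : Type*} [NormedAddCommGroup EB]
    [NormedSpace ℂ EB] [TopologicalSpace HB] [TopologicalSpace B] [ChartedSpace HB B]
    {IB : ModelWithCorners ℂ EB HB} [NormedAddCommGroup W] [NormedSpace ℂ W]
    {f : B → W} {j : W → B} {w : W} {p : B} (hf : MDifferentiableAt IB 𝓘(ℂ, W) f p)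
    (hj : MDifferentiableAt 𝓘(ℂ, W) IB j w) (hp : j w = p) (h : ∀ v, f (j v) = v) :
    Function.Surjective (mfderiv IB 𝓘(ℂ, W) f p) := by
  subst hp
  have hd := mfderiv_comp w hf hj
  -- The chain rule becomes `id = df ∘ dj`, so `dj v` is a preimage of `v`.
  rw [show f ∘ j = id from funext h, mfderiv_id] at hd
  exact fun v => ⟨mfderiv 𝓘(ℂ, W) IB j w v, (DFunLike.congr_fun hd v).symm⟩

namespace FlagType

variable {N : ℕ} (τ : FlagType N)

/-! ### The dimension of `X` and the rank of `E` -/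

/-- The number of pairs `(a, c)` with `c < d_i ≤ a` for some `i` is `Σ d_j (d_{j+1} - d_j)`: sort
them by the largest `j` with `d_j ≤ a`. -/
theorem card_idx : Fintype.card τ.Idx = τ.n := by
  have hle : ∀ i : Fin (τ.k - 1), τ.d (τ.lo i) ≤ τ.d ⟨i + 1, by omega⟩ := fun i =>
    τ.mono (Fin.le_def.2 (Nat.le_succ _))
  have hN : ∀ i : Fin (τ.k - 1), τ.d ⟨i + 1, by omega⟩ ≤ N := fun i => τ.d_le _
  -- The block `i` consists of the columns `c < d_i` and the rows `d_i + b` with `d_i ≤ d_i + b <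
  -- d_{i+1}`. These rectangles tile the positions of `𝔫`.
  let f : (Σ i : Fin (τ.k - 1), Fin (τ.d (τ.lo i)) ×
      Fin (τ.d ⟨i + 1, by omega⟩ - τ.d (τ.lo i))) → τ.Idx := fun s =>
    ⟨(⟨τ.d (τ.lo s.1) + s.2.2, by have := hle s.1; have := hN s.1; have := s.2.2.2; omega⟩,
      ⟨s.2.1, by have := hle s.1; have := hN s.1; have := s.2.1.2; omega⟩),
      τ.lo s.1, s.2.1.2, Nat.le_add_right _ _⟩
  have hf : Function.Bijective f := by
    constructor
    · rintro ⟨i, c, b⟩ ⟨j, c', b'⟩ h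
      have h1 : τ.d (τ.lo i) + (b : ℕ) = τ.d (τ.lo j) + b' :=
        congrArg (fun q : τ.Idx => (q.1.1 : ℕ)) h
      have h2 : (c : ℕ) = c' := congrArg (fun q : τ.Idx => (q.1.2 : ℕ)) h
      -- Row ranges of different blocks are disjoint: for `i < j`, rows of block `i` lie below the
      -- bound `d_{i+1} ≤ d_j`, where block `j` starts at the earliest.
      have key : ∀ i j : Fin (τ.k - 1), ∀ (b : Fin (τ.d ⟨i + 1, by omega⟩ - τ.d (τ.lo i))) (b' : ℕ),
          τ.d (τ.lo i) + (b : ℕ) = τ.d (τ.lo j) + b' → ¬ i < j := by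
        intro i j b b' h hij
        have h3 : τ.d ⟨i + 1, by omega⟩ ≤ τ.d (τ.lo j) := τ.mono (Fin.le_def.2 hij)
        have := b.2
        omega
      obtain rfl : i = j :=
        le_antisymm (not_lt.1 (key j i b' b h1.symm)) (not_lt.1 (key i j b b' h1))
      obtain rfl : c = c' := Fin.ext h2
      obtain rfl : b = b' := Fin.ext (by omega)
      rfl
    · intro q
      obtain ⟨i, hi1, hi2⟩ := exists_lo q
      -- The block of `(a, c)` is the largest `j` with `d_j ≤ a`. Repeated dimensions give empty
      -- blocks, and taking the largest index skips them.
      obtain ⟨j, hj, hmax⟩ := (Finset.univ.filter fun j : Fin (τ.k - 1) =>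
        τ.d (τ.lo j) ≤ (q.1.1 : ℕ)).exists_max_image id ⟨i, by simpa using hi2⟩
      have hj : τ.d (τ.lo j) ≤ (q.1.1 : ℕ) := by simpa using hj
      have hij : i ≤ j := hmax i (by simpa using hi2)
      -- Maximality of `j` gives `a < d_{j+1}`, except when `j + 1` is the last index, which lies
      -- outside the range of the maximum; there `d_k = N > a`.
      have hlt : (q.1.1 : ℕ) < τ.d ⟨j + 1, by omega⟩ := by
        by_contra! hcon
        by_cases hk : (j : ℕ) + 1 < τ.k - 1
        · have : (⟨j + 1, hk⟩ : Fin (τ.k - 1)) ≤ j :=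
            hmax ⟨j + 1, hk⟩ (Finset.mem_filter.2 ⟨Finset.mem_univ _, hcon⟩)
          exact Nat.not_succ_le_self _ (Fin.le_def.1 this)
        · have h1 : (⟨j + 1, by omega⟩ : Fin τ.k) =
              ⟨τ.k - 1, Nat.sub_lt τ.k_pos Nat.one_pos⟩ := Fin.ext (by simp only; omega)
          rw [h1, τ.d_last] at hcon
          have := q.1.1.2
          omega
      have hmono : τ.d (τ.lo i) ≤ τ.d (τ.lo j) := τ.mono hij
      refine ⟨⟨j, ⟨q.1.2, hi1.trans_le hmono⟩, ⟨q.1.1 - τ.d (τ.lo j), by omega⟩⟩, ?_⟩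
      refine Subtype.ext (Prod.ext (Fin.ext ?_) rfl)
      exact Nat.add_sub_of_le hj
  rw [← Fintype.card_of_bijective hf, Fintype.card_sigma]
  simp [n]

/-- The frame of the fibre exists for any matrices representing the two flags, so the count is the
same at every point, on and off the diagonal. -/
theorem finrank_E (p : τ.Flag × τ.Flag) : finrank ℂ (τ.E p) = τ.n := by
  rw [(kerFrame (τ.orbit_frameAt p.1) (τ.orbit_frameAt p.2)).finrank_eq,
    finrank_fintype_fun_eq_card, card_idx]

/-! ### `E` as a holomorphic subbundle -/

/-- Unfolds the bundle structure to the frame of the atlas chosen at `p`. No membership of `x` in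
the cells is needed, because `lift` represents `x` by some matrix everywhere. -/
theorem trivializationAt_E (p x : τ.Flag × τ.Flag) (f : τ.E x) :
    (trivializationAt (τ.Idx → ℂ) τ.E p ⟨x, f⟩).2 =
      kerFrame (τ.orbit_lift (τ.frameAt p.1) x.1) (τ.orbit_lift (τ.frameAt p.2) x.2) f := rfl

/-- The frame of `E` records each entry `(a, c)` for one chosen `i`; `sumCoord_eq` recovers it for
all other `i`. So in frames the inclusion only repeats coordinates, by a rule that does not depend
on the point. -/
theorem sumCoord_incl {z ζ : τ.Flag} {g h : GL (Fin N) ℂ} (hz : τ.orbit g = z)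
    (hζ : τ.orbit h = ζ) (f : τ.E (z, ζ)) :
    sumCoord hz hζ (τ.incl (z, ζ) f) = kerFrame hz hζ f ∘ toIdx := by
  funext t
  exact sumCoord_eq hz hζ f.2 _ _

theorem contMDiff_incl :
    ContMDiff ((𝓘(ℂ, τ.Idx → ℂ).prod 𝓘(ℂ, τ.Idx → ℂ)).prod 𝓘(ℂ, τ.Idx → ℂ))
      ((𝓘(ℂ, τ.Idx → ℂ).prod 𝓘(ℂ, τ.Idx → ℂ)).prod 𝓘(ℂ, τ.SumIdx → ℂ)) ω
      (fun v : Bundle.TotalSpace (τ.Idx → ℂ) τ.E =>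
        (⟨v.proj, τ.incl v.proj v.snd⟩ : Bundle.TotalSpace (τ.SumIdx → ℂ) τ.SumHom)) := by
  intro v₀
  -- Holomorphy of the identity of the total space of `E` yields that of the base point, `h1`, and
  -- of the fibre coordinates, `h2`. The inclusion composes the latter with the constant linear map
  -- `hL`.
  obtain ⟨h1, h2⟩ := Bundle.contMDiffAt_totalSpace.1 (contMDiffAt_id (x := v₀) (n := ω)
    (I := (𝓘(ℂ, τ.Idx → ℂ).prod 𝓘(ℂ, τ.Idx → ℂ)).prod 𝓘(ℂ, τ.Idx → ℂ)))
  refine Bundle.contMDiffAt_totalSpace.2 ⟨h1, ?_⟩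
  have hL : ContDiff ℂ ω fun (w : τ.Idx → ℂ) (t : τ.SumIdx) => w (toIdx t) :=
    contDiff_pi.2 fun t => contDiff_apply ℂ ℂ (toIdx t)
  refine (hL.contMDiff.contMDiffAt.comp v₀ h2).congr_of_eventuallyEq (.of_forall fun v => ?_)
  exact τ.sumCoord_incl _ _ v.snd

/-! ### The section `η` in the frames -/

/-- Since `η_i` is induced by the identity of `ℂ^N`, its matrix from the basis `h e_c` to the basis
`g e_a` is cut out of the change of basis `g⁻¹h`. -/
theorem sumCoord_eta {z ζ : τ.Flag} {g h : GL (Fin N) ℂ} (hz : τ.orbit g = z)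
    (hζ : τ.orbit h = ζ) (t : τ.SumIdx) :
    sumCoord hz hζ (τ.eta (z, ζ)) t = ((g⁻¹).1 * h.1) t.1.2.1 t.1.2.2 := by
  change ((g⁻¹).1 *ᵥ (h.1 *ᵥ Pi.single t.1.2.2 1)) t.1.2.1 = _
  rw [Matrix.mulVec_mulVec, Matrix.mulVec_single_one]
  rfl

theorem kerFrame_etaE {z ζ : τ.Flag} {g h : GL (Fin N) ℂ} (hz : τ.orbit g = z)
    (hζ : τ.orbit h = ζ) (t : τ.Idx) :
    kerFrame hz hζ (τ.etaE (z, ζ)) t = ((g⁻¹).1 * h.1) t.1.1 t.1.2 :=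
  τ.sumCoord_eta hz hζ (toSumIdx t)

/-- The common analytic input for `η` as a section of either bundle. The two lifts are holomorphic
only over their cells, which suffices because the product of the cells is an open neighbourhood of
`p`. -/
theorem contMDiffAt_lift_inv_mul_lift (p : τ.Flag × τ.Flag) (a c : Fin N) :
    ContMDiffAt (𝓘(ℂ, τ.Idx → ℂ).prod 𝓘(ℂ, τ.Idx → ℂ)) 𝓘(ℂ, ℂ) ω
      (fun x : τ.Flag × τ.Flag =>
        (((τ.lift (τ.frameAt p.1) x.1)⁻¹).1 * (τ.lift (τ.frameAt p.2) x.2).1) a c) p := by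
  let i := (τ.frameAt p.1, τ.frameAt p.2)
  have hp : p ∈ τ.cellProd i := ⟨τ.mem_cellHomeo_frameAt p.1, τ.mem_cellHomeo_frameAt p.2⟩
  refine (contMDiffOn_mul (s := τ.cellProd i) (fun a c => ?_) (fun a c => ?_) a c).contMDiffAt
    ((τ.isOpen_cellProd i).mem_nhds hp)
  · exact (τ.contMDiffOn_lift_inv i.1 a c).comp contMDiffOn_fst fun p hp => hp.1
  · exact (τ.contMDiffOn_lift i.2 a c).comp contMDiffOn_snd fun p hp => hp.2

theorem holomorphicSection_eta : HolomorphicSection (H := τ.Idx → ℂ) (τ.SumIdx → ℂ) τ.eta := by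
  intro p
  refine Bundle.contMDiffAt_totalSpace.2 ⟨contMDiffAt_id, contMDiffAt_pi_space.2 fun t => ?_⟩
  refine (τ.contMDiffAt_lift_inv_mul_lift p t.1.2.1 t.1.2.2).congr_of_eventuallyEq
    (.of_forall fun x => ?_)
  exact τ.sumCoord_eta _ _ t

theorem contMDiffAt_trivializationAt_etaE (p : τ.Flag × τ.Flag) :
    ContMDiffAt (𝓘(ℂ, τ.Idx → ℂ).prod 𝓘(ℂ, τ.Idx → ℂ)) 𝓘(ℂ, τ.Idx → ℂ) ω
      (fun x => (trivializationAt (τ.Idx → ℂ) τ.E p ⟨x, τ.etaE x⟩).2) p := by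
  refine contMDiffAt_pi_space.2 fun t => ?_
  refine (τ.contMDiffAt_lift_inv_mul_lift p t.1.1 t.1.2).congr_of_eventuallyEq
    (.of_forall fun x => ?_)
  exact τ.kerFrame_etaE _ _ t

theorem holomorphicSection_etaE : HolomorphicSection (H := τ.Idx → ℂ) (τ.Idx → ℂ) τ.etaE :=
  fun p => Bundle.contMDiffAt_totalSpace.2
    ⟨contMDiffAt_id, τ.contMDiffAt_trivializationAt_etaE p⟩

/-! ### The zero set of `η` -/

/-- The composite `H_{i,ζ} → ℂ^N → F_{i,z}` vanishes precisely when `V_i(ζ) ⊆ V_i(z)`, and both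
sides have dimension `d_i`. -/
theorem etaE_eq_zero_iff (p : τ.Flag × τ.Flag) : τ.etaE p = 0 ↔ p.1 = p.2 := by
  have hzero : τ.etaE p = 0 ↔ ∀ i : Fin (τ.k - 1), p.2.V (τ.lo i) ≤ p.1.V (τ.lo i) := by
    constructor
    · intro h i v hv
      have h1 : τ.eta p = 0 := congrArg Subtype.val h
      have h2 : τ.q (τ.lo i) p.1 v = 0 := LinearMap.congr_fun (congrFun h1 i) ⟨v, hv⟩
      simpa using h2
    · intro h
      refine Subtype.ext (funext fun i => LinearMap.ext fun v => ?_)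
      exact (Submodule.Quotient.mk_eq_zero _).2 (h i v.2)
  rw [hzero]
  constructor
  · intro h
    ext1
    funext i
    refine (Submodule.eq_of_le_of_finrank_eq ?_ (by rw [Flag.finrank_eq, Flag.finrank_eq])).symm
    -- The section `η` has no component at the last index, but there both subspaces are all of `ℂ^N`
    -- because `d_k = N`.
    by_cases hi : (i : ℕ) < τ.k - 1
    · exact h ⟨i, hi⟩
    · have hi' : i = ⟨τ.k - 1, Nat.sub_lt τ.k_pos Nat.one_pos⟩ :=
        Fin.ext (by have := i.2; simp only; omega)
      have htop : p.1.V i = ⊤ := Submodule.eq_top_of_finrank_eq (by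
        rw [Flag.finrank_eq, hi', τ.d_last, finrank_fin_fun])
      rw [htop]
      exact le_top
  · intro h i
    rw [h]

/-! ### First order vanishing along the diagonal -/

theorem cellHomeo_symm_zero (x : τ.Flag) : (τ.cellHomeo (τ.frameAt x)).symm 0 = x := by
  have := τ.orbit_mul_congr (τ.frameAt x) τ.orbit_unip_zero
  rw [mul_one, orbit_frameAt] at this
  exact this

theorem cellHomeo_symm_apply_mem (g : GL (Fin N) ℂ) (B : τ.Idx → ℂ) :
    (τ.cellHomeo g).symm B ∈ (τ.cellHomeo g).source :=
  (τ.cellHomeo g).map_target (Set.mem_univ B)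

theorem lift_cellHomeo_symm (g : GL (Fin N) ℂ) (B : τ.Idx → ℂ) :
    τ.lift g ((τ.cellHomeo g).symm B) = g * τ.unip B := by
  rw [lift, if_pos (τ.cellHomeo_symm_apply_mem g B),
    (τ.cellHomeo g).right_inv (Set.mem_univ B)]

theorem contMDiff_cellHomeo_symm (g : GL (Fin N) ℂ) :
    ContMDiff 𝓘(ℂ, τ.Idx → ℂ) 𝓘(ℂ, τ.Idx → ℂ) ω (τ.cellHomeo g).symm := by
  have := contMDiffOn_symm_of_mem_maximalAtlas (I := 𝓘(ℂ, τ.Idx → ℂ)) (n := ω)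
    (IsManifold.subset_maximalAtlas (τ.mem_atlas_iff.2 ⟨g, rfl⟩))
  exact contMDiffOn_univ.1 this

theorem unip_zero : τ.unip (0 : τ.Idx → ℂ) = 1 := by
  ext a c
  by_cases h : ∃ i : Fin τ.k, (c : ℕ) < τ.d i ∧ τ.d i ≤ (a : ℕ)
  · have hac : a ≠ c := by
      rintro rfl
      obtain ⟨i, h1, h2⟩ := h
      omega
    rw [unip_val, Units.val_one, Matrix.one_apply_ne hac]
    exact dif_pos h
  · exact dif_neg h

/-- In the frame around `(x, x)`, the section `η` restricted to the second factor is the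
coordinate `B` of the flag `g (1 + B) · F₀`. -/
theorem trivializationAt_etaE_cell (x : τ.Flag) (B : τ.Idx → ℂ) :
    (trivializationAt (τ.Idx → ℂ) τ.E (x, x)
      ⟨(x, (τ.cellHomeo (τ.frameAt x)).symm B),
        τ.etaE (x, (τ.cellHomeo (τ.frameAt x)).symm B)⟩).2 = B := by
  funext t
  rw [trivializationAt_E, kerFrame_etaE]
  -- The flag `x` is the point `B = 0` of its own cell, so its lift is `g(1 + 0) = g`.
  have hx : τ.lift (τ.frameAt x) x = τ.frameAt x := by
    have := τ.lift_cellHomeo_symm (τ.frameAt x) 0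
    rwa [cellHomeo_symm_zero, unip_zero, mul_one] at this
  -- Here `g⁻¹h = g⁻¹ · g(1 + B) = 1 + B`, whose entries at the positions of `𝔫` are those of `B`.
  rw [hx, lift_cellHomeo_symm, ← Units.val_mul, inv_mul_cancel_left]
  exact dif_pos t.2

theorem contMDiff_slice (x : τ.Flag) (g : GL (Fin N) ℂ) :
    ContMDiff 𝓘(ℂ, τ.Idx → ℂ) (𝓘(ℂ, τ.Idx → ℂ).prod 𝓘(ℂ, τ.Idx → ℂ)) ω
      fun B => (x, (τ.cellHomeo g).symm B) :=
  contMDiff_const.prodMk (τ.contMDiff_cellHomeo_symm g)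

/-- Moving the second factor alone is enough. The cell is parametrized by all of `𝔫`, so the slice
through `(x, x)` is a right inverse defined for every `B`. -/
theorem vanishesToFirstOrderAt_etaE (x : τ.Flag) :
    VanishesToFirstOrderAt (H := τ.Idx → ℂ) (τ.Idx → ℂ) τ.etaE (x, x) :=
  ⟨(τ.etaE_eq_zero_iff _).2 rfl, surjective_mfderiv_of_comp_eq_id
    ((τ.contMDiffAt_trivializationAt_etaE (x, x)).mdifferentiableAt (by simp))
    ((τ.contMDiff_slice x (τ.frameAt x)).mdifferentiable (by simp) 0)
    (congrArg (Prod.mk x) (τ.cellHomeo_symm_zero x)) (τ.trivializationAt_etaE_cell x)⟩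

theorem definesDiagonal_etaE : DefinesDiagonal (H := τ.Idx → ℂ) (τ.Idx → ℂ) τ.etaE := by
  constructor
  · rintro ⟨x, y⟩ h
    obtain rfl : x = y := h
    exact τ.vanishesToFirstOrderAt_etaE x
  · intro p hp h
    exact hp ((τ.etaE_eq_zero_iff p).1 h)

/-- The bundle is `E` itself. Its model fibre is the model space of `X`, so the equality of rank and
dimension is definitional. -/
theorem hasDiagonalProperty : HasDiagonalProperty (τ.Idx → ℂ) τ.Flag :=
  ⟨τ.Idx → ℂ, inferInstance, inferInstance, τ.E, inferInstance, inferInstance, inferInstance,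
    inferInstance, inferInstance, inferInstance, inferInstance, inferInstance, rfl,
    τ.etaE, τ.holomorphicSection_etaE, τ.definesDiagonal_etaE⟩

end FlagType

theorem mainTheorem4 (N : ℕ) (τ : FlagType N) :
    -- `dim X = n`, and `E` has rank `n`
    (∀ x : τ.Flag, finrank ℂ (TangentSpace 𝓘(ℂ, τ.Idx → ℂ) x) = τ.n) ∧
    (∀ p, finrank ℂ (τ.E p) = τ.n) ∧
    -- `E = ker Φ` is a holomorphic subbundle of `⊕ Hom(H_{i,ζ}, F_{i,z})`
    (∀ p, Function.Injective (τ.incl p) ∧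
      LinearMap.range (τ.incl p) = LinearMap.ker (τ.Phi p)) ∧
    ContMDiff ((𝓘(ℂ, τ.Idx → ℂ).prod 𝓘(ℂ, τ.Idx → ℂ)).prod 𝓘(ℂ, τ.Idx → ℂ))
      ((𝓘(ℂ, τ.Idx → ℂ).prod 𝓘(ℂ, τ.Idx → ℂ)).prod 𝓘(ℂ, τ.SumIdx → ℂ)) ω
      (fun v : Bundle.TotalSpace (τ.Idx → ℂ) τ.E =>
        (⟨v.proj, τ.incl v.proj v.snd⟩ : Bundle.TotalSpace (τ.SumIdx → ℂ) τ.SumHom)) ∧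
    -- `η` is a holomorphic section of `⊕ Hom(H_{i,ζ}, F_{i,z})` and of its subbundle `E`
    HolomorphicSection (H := τ.Idx → ℂ) (τ.SumIdx → ℂ) τ.eta ∧
    (∀ p, τ.incl p (τ.etaE p) = τ.eta p) ∧
    HolomorphicSection (H := τ.Idx → ℂ) (τ.Idx → ℂ) τ.etaE ∧
    -- `η` defines the diagonal
    DefinesDiagonal (H := τ.Idx → ℂ) (τ.Idx → ℂ) τ.etaE ∧
    -- so that `X` has the Diagonal Property
    HasDiagonalProperty (τ.Idx → ℂ) τ.Flag := by
  exact ⟨fun _ => (finrank_fintype_fun_eq_card ℂ).trans τ.card_idx, τ.finrank_E,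
    fun p => ⟨Subtype.val_injective, Submodule.range_subtype _⟩, τ.contMDiff_incl,
    τ.holomorphicSection_eta, fun _ => rfl, τ.holomorphicSection_etaE, τ.definesDiagonal_etaE,
    τ.hasDiagonalProperty⟩
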